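/- Let $K$ be a field of characteristic zero (for instance $K=\mathbb C$), let $q=v^2\in K^\times$, where $v=q^{1/2}\in K^\times$ is not a root of unity, and for a skew-symmetric integer $n\times n$ matrix $\Lambda=(\lambda_{ij})$ let $K_\Lambda[x_1^{\pm1},\dots,x_n^{\pm1}]$ be the quantum torus, with relations $x_ix_j=q^{\lambda_{ij}}x_jx_i$. Let $(\mathbf x=(x_1,\dots,x_n),B,\Lambda)$ be a quantum seed in the skew-field of fractions $\mathfrak F$ of $K_\Lambda[x_1^{\pm1},\dots,x_n^{\pm1}]$: $B$ is an integer matrix with columns labeled by $[1,n]$ and rows labeled by a subset $\mathbf{ex}\subseteq[1,n]$ of exchangeable indices, and $(B,\Lambda)$ is compatible, that is, $(B\Lambda)_{ij}=d_i\delta_{ij}$ with positive integers $d_i$. Let $\mathfrak A_q\subset\mathfrak F$ be the corresponding quantum cluster algebra, the $K$-subalgebra generated by the elements of the extended clusters of all quantum seeds which are mutation-equivalent to $(\mathbf x,B,\Lambda)$ (the frozen variables are not inverted). Assume that every prime ideal of $\mathfrak A_q$ is completely prime. Let $T=\ker B\subseteq\mathbb Z^n$. A two-sided ideal of $\mathfrak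 A_q$ is torus invariant if it is stable under the global toric actions $x_i\mapsto\alpha^{w_i}x_i$ for all $w\in T$, $\alpha\in K^\times$. Let $\Lambda_{[1,k]}$ be the $k$-th principal submatrix of $\Lambda$ and $T_{[1,k]}\subseteq\mathbb Z^k$ the projection of $T$ to the first $k$ coordinates. Assume that $\mathbf x$ is super-toric: $\operatorname{rk}(T_{[1,k]}+\operatorname{Im}\Lambda_{[1,k]})=k$ for $k=1,\dots,n$. Assume that $\mathbf x$ admits a co-dimension one stratification (COS) of depth $r\le n$: there are proper torus invariant prime ideals $$\mathcal I_n\subset\mathcal I_{n-1}\subset\dots\subset\mathcal I_{n-r+1}\subset\mathfrak A_q\quad\text{with}\quad \mathcal I_k\cap\mathbf x=\{x_k,\dots,x_n\}\quad (n-r<k\le n).$$ Then, for every $k$ with $n-r<k\le n$: (a) there is an injective homomorphism of $K$-algebras $$\mathfrak A_q/\mathcal I_k\hookrightarrow K_{\Lambda_{[1,k-1]}}[x_1^{\pm1},\dots,x_{k-1}^{\pm1}]$$ which sends the class of $x_i$ to $x_i$ for $1\le i\le k-1$; (b) every $a\in\mathfrak A_q$ has a unique Laurent expansion $a=\sum_{\mathbf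 m\in\mathbb Z^n}c_{\mathbf m}x^{\mathbf m}$ in $K_\Lambda[x_1^{\pm1},\dots,x_n^{\pm1}]$, and $a\in\mathcal I_k$ if and only if $c_{\mathbf m}=0$ for all $\mathbf m$ with $m_k=\dots=m_n=0$. -/

import Mathlib

namespace QCluster

/-! ### Quantum tori -/

section Torus

variable {K : Type*} [Field K] {J : Type*} [Fintype J]

/-- The integer bilinear form `Λ(a, b) = aᵀ Λ b` on `ℤ^J`. -/
def form (Λ : Matrix J J ℤ) (a b : J → ℤ) : ℤ := dotProduct a (Λ.mulVec b)

lemma form_add_left (Λ : Matrix J J ℤ) (a b c : J → ℤ) :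
    form Λ (a + b) c = form Λ a c + form Λ b c := by
  simp [form, add_dotProduct]

lemma form_add_right (Λ : Matrix J J ℤ) (a b c : J → ℤ) :
    form Λ a (b + c) = form Λ a b + form Λ a c := by
  simp [form, Matrix.mulVec_add, dotProduct_add]

lemma form_zero_left (Λ : Matrix J J ℤ) (a : J → ℤ) : form Λ 0 a = 0 := by
  simp [form]

lemma form_zero_right (Λ : Matrix J J ℤ) (a : J → ℤ) : form Λ a 0 = 0 := by
  simp [form]

/-- The twisted product of finitely supported functions on `ℤ^J`, determined by
`X^a X^b = v^{Λ(a,b)} X^{a+b}`. -/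
noncomputable def twistedMul (v : Kˣ) (Λ : Matrix J J ℤ) (f g : (J → ℤ) →₀ K) : (J → ℤ) →₀ K :=
  f.sum fun a x => g.sum fun b y =>
    Finsupp.single (a + b) (((v ^ form Λ a b : Kˣ) : K) * (x * y))

section TwistedMul

variable (v : Kˣ) (Λ : Matrix J J ℤ)

lemma twistedMul_zero_left (f : (J → ℤ) →₀ K) : twistedMul v Λ 0 f = 0 := by
  simp [twistedMul]

lemma twistedMul_zero_right (f : (J → ℤ) →₀ K) : twistedMul v Λ f 0 = 0 := by
  simp [twistedMul]

lemma twistedMul_add_left (f g h : (J → ℤ) →₀ K) :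
    twistedMul v Λ (f + g) h = twistedMul v Λ f h + twistedMul v Λ g h := by
  unfold twistedMul
  refine Finsupp.sum_add_index' (fun a => by simp) (fun a x y => ?_)
  rw [← Finsupp.sum_add]
  exact Finset.sum_congr rfl fun b _ => by simp only [← Finsupp.single_add]; congr 1; ring

lemma twistedMul_add_right (f g h : (J → ℤ) →₀ K) :
    twistedMul v Λ f (g + h) = twistedMul v Λ f g + twistedMul v Λ f h := by
  unfold twistedMul
  rw [← Finsupp.sum_add]
  refine Finset.sum_congr rfl fun a _ => ?_
  refine Finsupp.sum_add_index' (fun b => by simp) (fun b x y => ?_)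
  rw [← Finsupp.single_add]; congr 1; ring

lemma twistedMul_single (a b : J → ℤ) (x y : K) :
    twistedMul v Λ (Finsupp.single a x) (Finsupp.single b y) =
      Finsupp.single (a + b) (((v ^ form Λ a b : Kˣ) : K) * (x * y)) := by
  unfold twistedMul
  rw [Finsupp.sum_single_index (by simp), Finsupp.sum_single_index (by simp)]

lemma twistedMul_assoc (f g h : (J → ℤ) →₀ K) :
    twistedMul v Λ (twistedMul v Λ f g) h = twistedMul v Λ f (twistedMul v Λ g h) := by
  induction f using Finsupp.induction_linear with
  | zero => simp only [twistedMul_zero_left]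
  | add f₁ f₂ h₁ h₂ => simp only [twistedMul_add_left, h₁, h₂]
  | single a x =>
    induction g using Finsupp.induction_linear with
    | zero => simp only [twistedMul_zero_left, twistedMul_zero_right]
    | add f₁ f₂ h₁ h₂ => simp only [twistedMul_add_left, twistedMul_add_right, h₁, h₂]
    | single b y =>
      induction h using Finsupp.induction_linear with
      | zero => simp only [twistedMul_zero_right]
      | add f₁ f₂ h₁ h₂ => simp only [twistedMul_add_right, h₁, h₂]
      | single c z =>
        simp only [twistedMul_single, form_add_left, form_add_right, zpow_add, Units.val_mul,
          add_assoc]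
        congr 1
        ring

lemma twistedMul_one_left (f : (J → ℤ) →₀ K) : twistedMul v Λ (Finsupp.single 0 1) f = f := by
  induction f using Finsupp.induction_linear with
  | zero => simp only [twistedMul_zero_right]
  | add f₁ f₂ h₁ h₂ => simp only [twistedMul_add_right, h₁, h₂]
  | single a x => simp [twistedMul_single, form_zero_left]

lemma twistedMul_one_right (f : (J → ℤ) →₀ K) : twistedMul v Λ f (Finsupp.single 0 1) = f := by
  induction f using Finsupp.induction_linear with
  | zero => simp only [twistedMul_zero_left]
  | add f₁ f₂ h₁ h₂ => simp only [twistedMul_add_left, h₁, h₂]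
  | single a x => simp [twistedMul_single, form_zero_right]

lemma twistedMul_smul_left (r : K) (f g : (J → ℤ) →₀ K) :
    twistedMul v Λ (r • f) g = r • twistedMul v Λ f g := by
  induction f using Finsupp.induction_linear with
  | zero => simp only [twistedMul_zero_left, smul_zero]
  | add f₁ f₂ h₁ h₂ => simp only [twistedMul_add_left, smul_add, h₁, h₂]
  | single a x =>
    induction g using Finsupp.induction_linear with
    | zero => simp only [twistedMul_zero_right, smul_zero]
    | add f₁ f₂ h₁ h₂ => simp only [twistedMul_add_right, smul_add, h₁, h₂]
    | single b y =>
      simp only [Finsupp.smul_single, twistedMul_single, smul_eq_mul]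
      congr 1
      ring

lemma twistedMul_smul_right (r : K) (f g : (J → ℤ) →₀ K) :
    twistedMul v Λ f (r • g) = r • twistedMul v Λ f g := by
  induction f using Finsupp.induction_linear with
  | zero => simp only [twistedMul_zero_left, smul_zero]
  | add f₁ f₂ h₁ h₂ => simp only [twistedMul_add_left, smul_add, h₁, h₂]
  | single a x =>
    induction g using Finsupp.induction_linear with
    | zero => simp only [twistedMul_zero_right, smul_zero]
    | add f₁ f₂ h₁ h₂ => simp only [twistedMul_add_right, smul_add, h₁, h₂]
    | single b y =>
      simp only [Finsupp.smul_single, twistedMul_single, smul_eq_mul]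
      congr 1
      ring

end TwistedMul

/-- Rescaling of Laurent monomials: `X^a ↦ α^{w · a} X^a`. -/
noncomputable def rescale (α : Kˣ) (w : J → ℤ) : ((J → ℤ) →₀ K) →ₗ[K] ((J → ℤ) →₀ K) :=
  Finsupp.lsum K fun a => ((α ^ dotProduct w a : Kˣ) : K) • Finsupp.lsingle a

lemma rescale_single (α : Kˣ) (w a : J → ℤ) (c : K) :
    rescale α w (Finsupp.single a c) =
      Finsupp.single a (((α ^ dotProduct w a : Kˣ) : K) * c) := by
  simp [rescale]

lemma rescale_twistedMul (v : Kˣ) (Λ : Matrix J J ℤ) (α : Kˣ) (w : J → ℤ)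
    (f g : (J → ℤ) →₀ K) :
    rescale α w (twistedMul v Λ f g) = twistedMul v Λ (rescale α w f) (rescale α w g) := by
  induction f using Finsupp.induction_linear with
  | zero => simp only [twistedMul_zero_left, map_zero]
  | add f₁ f₂ h₁ h₂ => simp only [twistedMul_add_left, map_add, h₁, h₂]
  | single a x =>
    induction g using Finsupp.induction_linear with
    | zero => simp only [twistedMul_zero_right, map_zero]
    | add f₁ f₂ h₁ h₂ => simp only [twistedMul_add_right, map_add, h₁, h₂]
    | single b y =>
      simp only [twistedMul_single, rescale_single, dotProduct_add, zpow_add, Units.val_mul]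
      congr 1
      ring

/-- The quantum torus `K_Λ[x_j^{±1} : j ∈ J]` with `q = v ^ 2` (so `v = q^{1/2}`), for a
skew-symmetric integer matrix `Λ`. It is the `K`-vector space with basis the (normalized) Laurent
monomials `X^a`, `a ∈ ℤ^J`, and multiplication `X^a X^b = v^{Λ(a,b)} X^{a+b}`; hence
`x_i x_j = q^{λ_ij} x_j x_i` for `x_i = X^{e_i}`. The monomial `x_1^{a_1} ⋯ x_n^{a_n}` is `X^a` up
to a power of `v`. -/
@[nolint unusedArguments]
def QuantumTorus (_v : Kˣ) (_Λ : Matrix J J ℤ) : Type _ := (J → ℤ) →₀ K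

namespace QuantumTorus

variable (v : Kˣ) (Λ : Matrix J J ℤ)

noncomputable instance : AddCommGroup (QuantumTorus v Λ) :=
  inferInstanceAs (AddCommGroup ((J → ℤ) →₀ K))

noncomputable instance : Module K (QuantumTorus v Λ) :=
  inferInstanceAs (Module K ((J → ℤ) →₀ K))

noncomputable instance : Ring (QuantumTorus v Λ) :=
  { (inferInstance : AddCommGroup (QuantumTorus v Λ)) with
    mul := twistedMul v Λ
    one := (Finsupp.single 0 1 : (J → ℤ) →₀ K)
    left_distrib := twistedMul_add_right v Λ
    right_distrib := twistedMul_add_left v Λ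
    zero_mul := twistedMul_zero_left v Λ
    mul_zero := twistedMul_zero_right v Λ
    mul_assoc := twistedMul_assoc v Λ
    one_mul := twistedMul_one_left v Λ
    mul_one := twistedMul_one_right v Λ }

noncomputable instance : Algebra K (QuantumTorus v Λ) :=
  Algebra.ofModule (twistedMul_smul_left v Λ) (twistedMul_smul_right v Λ)

/-- The term `c X^a`. -/
noncomputable def term (a : J → ℤ) (c : K) : QuantumTorus v Λ :=
  (Finsupp.single a c : (J → ℤ) →₀ K)

/-- The generator `x_j`. -/
noncomputable def X [DecidableEq J] (j : J) : QuantumTorus v Λ := term v Λ (Pi.single j 1) 1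

/-- The coefficient of the Laurent monomial `X^a`. -/
def coeff {v : Kˣ} {Λ : Matrix J J ℤ} (f : QuantumTorus v Λ) (a : J → ℤ) : K :=
  DFunLike.coe (F := (J → ℤ) →₀ K) f a

/-- The toric action of `α ∈ Kˣ` with weight `w ∈ ℤ^J`: the algebra endomorphism (in fact an
automorphism) `X^a ↦ α^{w · a} X^a`; in particular `x_j ↦ α^{w_j} x_j`. -/
noncomputable def toricAction (α : Kˣ) (w : J → ℤ) : QuantumTorus v Λ →ₐ[K] QuantumTorus v Λ :=
  AlgHom.ofLinearMap (A := QuantumTorus v Λ) (B := QuantumTorus v Λ) (rescale α w)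
    ((rescale_single α w 0 1).trans (by simp; rfl))
    (rescale_twistedMul v Λ α w)

end QuantumTorus

end Torus

/-! ### Quantum seeds, mutation and quantum cluster algebras -/

section Cluster

variable {K : Type*} [Field K] {F : Type*} [DivisionRing F] [Algebra K F]
variable {n : ℕ} {ex : Finset (Fin n)}

/-- The data `(x, B, Λ)` of a seed: an extended cluster `x = (x_1, …, x_n)`, an exchange matrix `B`
whose rows are labeled by the exchangeable indices `ex`, and an `n × n`-matrix `Λ`. -/
structure SeedData (F : Type*) {n : ℕ} (ex : Finset (Fin n)) where
  /-- the extended cluster -/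
  x : Fin n → F
  /-- the exchange matrix -/
  B : Matrix ex (Fin n) ℤ
  /-- the matrix of the quasi-commutation relations of the cluster -/
  Λ : Matrix (Fin n) (Fin n) ℤ

/-- The value at `c ∈ ℤ^n` of the toric frame determined by the quasi-commuting elements
`x_1, …, x_n`: the normalized monomial
`M(c) = q^{(1/2) ∑_{i<j} c_i c_j λ_{ji}} x_1^{c_1} ⋯ x_n^{c_n}`, where `q^{1/2} = v`. -/
noncomputable def SeedData.frame (v : Kˣ) (s : SeedData F ex) (c : Fin n → ℤ) : F :=
  ((v ^ (∑ i, ∑ j, if i < j then c i * c j * s.Λ j i else 0) : Kˣ) : K) •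
    (List.ofFn fun i => s.x i ^ c i).prod

/-- The matrix `E_k = E_{k,+}` governing the mutation of `Λ` in direction `k`. -/
def mutE (B : Matrix ex (Fin n) ℤ) (k : ex) : Matrix (Fin n) (Fin n) ℤ :=
  fun i j => if j = k then (if i = k then -1 else max 0 (-B k i)) else (if i = j then 1 else 0)

/-- Matrix mutation of `B` in direction `k`. The quotient by `2` is exact. -/
def mutB (B : Matrix ex (Fin n) ℤ) (k : ex) : Matrix ex (Fin n) ℤ :=
  fun i j => if i = k ∨ j = (k : Fin n) then -B i j
    else B i j + (|B i k| * B k j + B i k * |B k j|) / 2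

/-- Mutation of a quantum seed in direction `k ∈ ex`: the variable `x_k` is replaced by
`x_k' = M(-e_k + ∑_{b_{ki} > 0} b_{ki} e_i) + M(-e_k - ∑_{b_{ki} < 0} b_{ki} e_i)`,
`B` by its matrix mutation and `Λ` by `E_kᵀ Λ E_k`. -/
noncomputable def SeedData.mutate (v : Kˣ) (s : SeedData F ex) (k : ex) : SeedData F ex where
  x := Function.update s.x k
    (s.frame v (-Pi.single (k : Fin n) 1 + fun i => max (s.B k i) 0) +
      s.frame v (-Pi.single (k : Fin n) 1 + fun i => max (-s.B k i) 0))
  B := mutB s.B k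
  Λ := (mutE s.B k).transpose * s.Λ * mutE s.B k

/-- The seeds obtained from `s` by finite sequences of mutations. -/
def SeedData.MutationEquiv (v : Kˣ) (s t : SeedData F ex) : Prop :=
  Relation.ReflTransGen (fun s₁ s₂ => ∃ k, s₂ = s₁.mutate v k) s t

/-- A quantum seed in the skew-field `F`: a compatible pair `(B, Λ)` together with a toric frame
`M : ℤ^n → F`, `M(c) = ι(X^c)`, where `ι` identifies `F` with the skew-field of fractions of the
quantum torus of `Λ`. -/
structure QuantumSeed (F : Type*) [DivisionRing F] [Algebra K F] (v : Kˣ) {n : ℕ}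
    (ex : Finset (Fin n)) where
  /-- the exchange matrix -/
  B : Matrix ex (Fin n) ℤ
  /-- the matrix of the quasi-commutation relations -/
  Λ : Matrix (Fin n) (Fin n) ℤ
  skew : Λ.transpose = -Λ
  compatible : ∃ d : ex → ℤ, (∀ i, 0 < d i) ∧
    ∀ i j, (B * Λ) i j = if (i : Fin n) = j then d i else 0
  /-- the embedding of the quantum torus into its skew-field of fractions -/
  ι : QuantumTorus v Λ →ₐ[K] F
  injective : Function.Injective ι
  fraction : ∀ z : F, ∃ a b, b ≠ 0 ∧ z = ι a * (ι b)⁻¹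

namespace QuantumSeed

variable {v : Kˣ} (S : QuantumSeed F v ex)

/-- The triple `(x, B, Λ)` of a quantum seed, where `x_i = M(e_i)`. -/
noncomputable def toSeedData : SeedData F ex where
  x i := S.ι (QuantumTorus.X v S.Λ i)
  B := S.B
  Λ := S.Λ

/-- The quantum cluster algebra of a quantum seed: the subalgebra of `F` generated by the elements
of the (extended) clusters of all seeds which are mutation-equivalent to it. The coefficients
(frozen variables) are not inverted. -/
noncomputable def clusterAlgebra : Subalgebra K F :=
  Algebra.adjoin K {z | ∃ t, S.toSeedData.MutationEquiv v t ∧ ∃ i, z = t.x i}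

/-- The cluster variable `x_i` of the seed, as an element of the quantum cluster algebra. -/
noncomputable def var (i : Fin n) : S.clusterAlgebra :=
  ⟨S.toSeedData.x i, Algebra.subset_adjoin ⟨_, Relation.ReflTransGen.refl, i, rfl⟩⟩

end QuantumSeed

end Cluster

/-! ### Prime ideals -/

section Prime

variable {R : Type*} [Ring R]

/-- A prime ideal of a not necessarily commutative ring: a proper two-sided ideal `P` such that
`a R b ⊆ P` implies `a ∈ P` or `b ∈ P`. -/
def IsPrimeIdeal (P : TwoSidedIdeal R) : Prop :=
  P ≠ ⊤ ∧ ∀ a b : R, (∀ r, a * r * b ∈ P) → a ∈ P ∨ b ∈ P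

/-- A completely prime ideal: a proper two-sided ideal `P` such that `a b ∈ P` implies `a ∈ P` or
`b ∈ P`. -/
def IsCompletelyPrime (P : TwoSidedIdeal R) : Prop :=
  P ≠ ⊤ ∧ ∀ a b : R, a * b ∈ P → a ∈ P ∨ b ∈ P

end Prime

/-! ### Torus invariance, super-toric clusters and stratifications -/

namespace QuantumSeed

variable {K : Type*} [Field K] {F : Type*} [DivisionRing F] [Algebra K F]
variable {n : ℕ} {ex : Finset (Fin n)} {v : Kˣ} (S : QuantumSeed F v ex)

/-- The lattice `T = ker B ⊆ ℤ^n` of the weights `w` whose toric action `x_i ↦ α^{w_i} x_i` extends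
to a global toric action on the quantum cluster algebra. -/
def weights : Submodule ℤ (Fin n → ℤ) := LinearMap.ker S.B.mulVecLin

/-- A two-sided ideal of the quantum cluster algebra is torus invariant if it is stable under all
global toric actions. The elements of the quantum cluster algebra are Laurent polynomials in
`x_1, …, x_n`, and the action with weight `w ∈ T` multiplies the monomial `x^m` by `α^{w · m}`. -/
def IsTorusInvariant (I : TwoSidedIdeal S.clusterAlgebra) : Prop :=
  ∀ w ∈ S.weights, ∀ α : Kˣ, ∀ f : QuantumTorus v S.Λ, ∀ hf : S.ι f ∈ S.clusterAlgebra,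
    (⟨S.ι f, hf⟩ : S.clusterAlgebra) ∈ I →
      ∃ hf' : S.ι (QuantumTorus.toricAction v S.Λ α w f) ∈ S.clusterAlgebra,
        (⟨S.ι (QuantumTorus.toricAction v S.Λ α w f), hf'⟩ : S.clusterAlgebra) ∈ I

/-- The principal submatrix `Λ_{[1,k]}`. -/
def principal (k : ℕ) (hk : k ≤ n) : Matrix (Fin k) (Fin k) ℤ :=
  S.Λ.submatrix (Fin.castLE hk) (Fin.castLE hk)

/-- The cluster is super-toric: `rk (T_{[1,k]} + Im Λ_{[1,k]}) = k` for `k = 1, …, n`, where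
`T_{[1,k]} ⊆ ℤ^k` is the projection of `T` to the first `k` coordinates. -/
def IsSuperToric : Prop :=
  ∀ (k : ℕ) (hk : k ≤ n), 1 ≤ k →
    Module.finrank ℤ
      ↥(S.weights.map (LinearMap.funLeft ℤ ℤ (Fin.castLE hk)) ⊔
        LinearMap.range (S.principal k hk).mulVecLin) = k

/-- A co-dimension one stratification of depth `r ≤ n`: a chain
`I_n ⊆ I_{n-1} ⊆ ⋯ ⊆ I_{n-r+1}` of torus invariant (proper) prime ideals with
`I_k ∩ {x_1, …, x_n} = {x_k, …, x_n}`. Only the values `I k` with `n - r < k ≤ n` matter; the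
variable `x_k` is the one with index `k - 1` in `Fin n`. -/
structure IsCOS (r : ℕ) (I : ℕ → TwoSidedIdeal S.clusterAlgebra) : Prop where
  depth_le : r ≤ n
  prime : ∀ k, n < k + r → k ≤ n → IsPrimeIdeal (I k)
  torusInvariant : ∀ k, n < k + r → k ≤ n → S.IsTorusInvariant (I k)
  var_mem_iff : ∀ k, n < k + r → k ≤ n → ∀ i : Fin n, S.var i ∈ I k ↔ k ≤ (i : ℕ) + 1
  chain : ∀ k, n < k + r → k + 1 ≤ n → I (k + 1) ≤ I k

end QuantumSeed

end QCluster

namespace QCluster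

/-! ### The bilinear form and compatible pairs -/

section Form

variable {J : Type*} [Fintype J] (Λ : Matrix J J ℤ)

/-! Regard the cluster algebra `A` as an algebra of Laurent polynomials in the initial cluster, and
let `π_t` keep only the monomials in the first `t` variables. Everything reduces to one claim:
`π_{k-1}` is multiplicative on `A` and its kernel there is `I_k`. Then the quotient embeds in the
quantum torus of the first `k-1` variables, and membership in `I_k` is the vanishing of the
coefficients kept by `π_{k-1}`.

That `A` consists of Laurent polynomials is the quantum Laurent phenomenon,
`clusterAlgebra_le_range`. It is proved with upper bounds: for each exchangeable `j`, consider the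
algebra generated by `x_j`, the mutated `x_j'` and all `x_i^{±1}` with `i ≠ j`. The intersection of
these algebras can only shrink or stay the same when read back through a mutation
(`inUpperBound_of_mutate`). In a direction `j` other than the mutated direction `k`, powers of
`x_k'` clear denominators, and `x_k'`, a sum of two monomials, is then cancelled: conjugation by
`x_k` gives the two monomials different degrees because `v` is not a root of unity
(`sum_mem_of_mul_sum_mem`).

The claim is proved by descending induction on `k`, with the zero ideal in the role of `I_{n+1}`.
Suppose `π_k` is multiplicative with kernel `I_{k+1} ⊆ I_k`. Monomials with nonnegative exponents
which involve one of `x_k, …, x_n` lie in `I_k`. On the other hand a polynomial in `x_1, …, x_{k-1}`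
lying in `I_k` is zero (`eq_zero_of_mem`): the global toric actions, together with conjugation by
`x_1, …, x_{k-1}`, separate its monomials by the super-toric condition, so a nonzero one would yield
a monomial in `I_k`, hence, by complete primality, a variable which is not there.

Consequently `π_k(a)` has no negative power of `x_k` for `a ∈ A` (`nonneg_of_coeff_ne_zero`):
otherwise multiply by a monomial clearing denominators which contains `x_k`. The product lies in
`I_k`, yet it retains a nonzero part free of `x_k`. So `x_k` may be set to zero in `π_k(A)`, which
makes `π_{k-1}` multiplicative, and its kernel is found by clearing the remaining denominators with
a monomial outside `I_k` (`isHeadKernel`). -/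

lemma form_smul_left (z : ℤ) (a b : J → ℤ) : form Λ (z • a) b = z * form Λ a b := by
  rw [form, smul_dotProduct, smul_eq_mul, form]

lemma form_smul_right (z : ℤ) (a b : J → ℤ) : form Λ a (z • b) = z * form Λ a b := by
  rw [form, Matrix.mulVec_smul, dotProduct_smul, smul_eq_mul, form]

lemma form_neg_left (a b : J → ℤ) : form Λ (-a) b = -form Λ a b := by
  simp [form]

lemma form_neg_right (a b : J → ℤ) : form Λ a (-b) = -form Λ a b := by
  simp [form, Matrix.mulVec_neg]

variable {Λ}

lemma form_antisymm (hΛ : Λ.transpose = -Λ) (a b : J → ℤ) : form Λ a b = -form Λ b a := by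
  rw [form, Matrix.dotProduct_mulVec, ← Matrix.mulVec_transpose, hΛ, dotProduct_comm,
    Matrix.neg_mulVec, dotProduct_neg, form]

lemma form_self (hΛ : Λ.transpose = -Λ) (a : J → ℤ) : form Λ a a = 0 := by
  have := form_antisymm hΛ a a
  omega

variable [DecidableEq J]

lemma form_single_single (i j : J) : form Λ (Pi.single i 1) (Pi.single j 1) = Λ i j := by
  simp [form]

end Form

lemma zpow_inj_of_not_root {K : Type*} [Field K] {v : Kˣ} (hv : ∀ m : ℕ, 0 < m → v ^ m ≠ 1) :
    Function.Injective fun e : ℤ => v ^ e := by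
  refine injective_zpow_iff_not_isOfFinOrder.2 fun h => ?_
  obtain ⟨m, hm, h⟩ := isOfFinOrder_iff_pow_eq_one.1 h
  exact hv m hm h

section Compatible

variable {n : ℕ} {ex : Finset (Fin n)}

/-- A compatible pair: a skew-symmetric `Λ` together with `B` such that `BΛ = (D 0)` with
positive `D`. -/
structure IsCompatible (B : Matrix ex (Fin n) ℤ) (Λ : Matrix (Fin n) (Fin n) ℤ) (d : ex → ℤ) :
    Prop where
  skew : Λ.transpose = -Λ
  pos : ∀ i, 0 < d i
  form_row : ∀ i a, form Λ (B i) a = d i * a i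

lemma isCompatible_of_mul {B : Matrix ex (Fin n) ℤ} {Λ : Matrix (Fin n) (Fin n) ℤ} {d : ex → ℤ}
    (hΛ : Λ.transpose = -Λ) (hd : ∀ i, 0 < d i)
    (h : ∀ i j, (B * Λ) i j = if (i : Fin n) = j then d i else 0) : IsCompatible B Λ d := by
  refine ⟨hΛ, hd, fun i a => ?_⟩
  rw [form, Matrix.dotProduct_mulVec, dotProduct]
  have : ∀ j, Matrix.vecMul (B i) Λ j = if (i : Fin n) = j then d i else 0 := fun j => h i j
  simp [this]

/-- The exponent `-e_k + ∑_{b_{ki} > 0} b_{ki} e_i`. -/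
def posExp (B : Matrix ex (Fin n) ℤ) (k : ex) : Fin n → ℤ :=
  -Pi.single (k : Fin n) 1 + fun i => max (B k i) 0

/-- The exponent `-e_k - ∑_{b_{ki} < 0} b_{ki} e_i`. -/
def negExp (B : Matrix ex (Fin n) ℤ) (k : ex) : Fin n → ℤ :=
  -Pi.single (k : Fin n) 1 + fun i => max (-B k i) 0

lemma posExp_eq (B : Matrix ex (Fin n) ℤ) (k : ex) : posExp B k = negExp B k + B k := by
  funext i
  simp only [posExp, negExp, Pi.add_apply]
  have : max (B k i) 0 = max (-B k i) 0 + B k i := by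
    rcases le_total (B k i) 0 with h | h
    · rw [max_eq_right h, max_eq_left (by omega)]; ring
    · rw [max_eq_left h, max_eq_right (by omega)]; ring
  rw [this]; ring

/-- The linear map fixing `e_i` for `i ≠ k` and mapping `e_k` to `p`. -/
def substExp (k : Fin n) (p a : Fin n → ℤ) : Fin n → ℤ := a + a k • (p - Pi.single k 1)

lemma substExp_of_zero {k : Fin n} {p a : Fin n → ℤ} (h : a k = 0) : substExp k p a = a := by
  simp [substExp, h]

lemma substExp_single (k : Fin n) (p : Fin n → ℤ) : substExp k p (Pi.single k 1) = p := by
  simp [substExp]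

lemma substExp_add (k : Fin n) (p a b : Fin n → ℤ) :
    substExp k p (a + b) = substExp k p a + substExp k p b := by
  simp only [substExp, Pi.add_apply, add_smul]; abel

lemma substExp_apply_of_ne {k j : Fin n} (hj : j ≠ k) (p a : Fin n → ℤ) :
    substExp k p a j = a j + a k * p j := by
  simp [substExp, Pi.single_eq_of_ne hj]

namespace IsCompatible

variable {B : Matrix ex (Fin n) ℤ} {Λ : Matrix (Fin n) (Fin n) ℤ} {d : ex → ℤ}

/-- Skew-symmetry of `Λ` evaluated on two rows of `B`. All sign rules for the square part of `B`
come from here. -/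
lemma row_symm (h : IsCompatible B Λ d) (i k : ex) : d i * B k i = -(d k * B i k) := by
  rw [← h.form_row, ← h.form_row, form_antisymm h.skew]

lemma row_self (h : IsCompatible B Λ d) (k : ex) : B k k = 0 := by
  have h1 := h.row_symm k k
  have h2 := h.pos k
  have : d k * B k k = 0 := by omega
  rcases mul_eq_zero.1 this with h | h
  · omega
  · exact h

lemma row_symm_nonpos (h : IsCompatible B Λ d) {i k : ex} (hik : 0 ≤ B k i) : B i k ≤ 0 := by
  have h1 := h.row_symm i k
  have h2 := h.pos k
  have h3 := h.pos i
  by_contra hc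
  push Not at hc
  have := mul_pos h2 hc
  have := mul_nonneg h3.le hik
  omega

lemma row_symm_nonneg (h : IsCompatible B Λ d) {i k : ex} (hik : B k i ≤ 0) : 0 ≤ B i k := by
  have h1 := h.row_symm i k
  have h2 := h.pos k
  have h3 := h.pos i
  by_contra hc
  push Not at hc
  have := mul_neg_of_pos_of_neg h2 hc
  have := mul_nonpos_of_nonneg_of_nonpos h3.le hik
  omega

lemma row_symm_eq_zero (h : IsCompatible B Λ d) {i k : ex} (hik : B k i = 0) : B i k = 0 :=
  le_antisymm (h.row_symm_nonpos hik.ge) (h.row_symm_nonneg hik.le)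

lemma negExp_self (h : IsCompatible B Λ d) (k : ex) : negExp B k k = -1 := by
  simp [negExp, h.row_self]

lemma posExp_self (h : IsCompatible B Λ d) (k : ex) : posExp B k k = -1 := by
  simp [posExp, h.row_self]

/-- The mutation of the matrix `Λ` in direction `k`. -/
def mutΛ (B : Matrix ex (Fin n) ℤ) (Λ : Matrix (Fin n) (Fin n) ℤ) (k : ex) :
    Matrix (Fin n) (Fin n) ℤ :=
  (mutE B k).transpose * Λ * mutE B k

lemma mutE_mulVec (h : IsCompatible B Λ d) (k : ex) (a : Fin n → ℤ) :
    (mutE B k).mulVec a = substExp k (negExp B k) a := by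
  funext i
  rw [Matrix.mulVec, dotProduct, ← Finset.add_sum_erase _ _ (Finset.mem_univ (k : Fin n))]
  by_cases hi : i = k
  · subst hi
    rw [Finset.sum_eq_zero]
    · simp [mutE, substExp, h.negExp_self]; ring
    · intro j hj
      have hj := Finset.ne_of_mem_erase hj
      simp [mutE, hj, hj.symm]
  · rw [substExp_apply_of_ne hi, Finset.sum_eq_single i]
    · simp [mutE, hi, negExp, max_comm]; ring
    · intro j hj hji
      have hj := Finset.ne_of_mem_erase hj
      simp [mutE, hj, hji.symm]
    · intro h
      simp [hi] at h

lemma form_mutΛ (h : IsCompatible B Λ d) (k : ex) (a b : Fin n → ℤ) :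
    form (mutΛ B Λ k) a b = form Λ (substExp k (negExp B k) a) (substExp k (negExp B k) b) := by
  rw [← h.mutE_mulVec, ← h.mutE_mulVec, form, form, mutΛ, ← Matrix.mulVec_mulVec,
    ← Matrix.mulVec_mulVec, Matrix.dotProduct_mulVec, Matrix.vecMul_transpose]

/-- The mutation of `Λ` does not depend on the choice of sign: the two substitutions differ by `a k
• B k`, and the two resulting cross terms, evaluated by compatibility, cancel. -/
lemma form_mutΛ' (h : IsCompatible B Λ d) (k : ex) (a b : Fin n → ℤ) :
    form (mutΛ B Λ k) a b = form Λ (substExp k (posExp B k) a) (substExp k (posExp B k) b) := by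
  have key : ∀ a, substExp k (posExp B k) a = substExp k (negExp B k) a + a k • B k := fun a => by
    rw [substExp, substExp, posExp_eq, add_sub_right_comm, smul_add, ← add_assoc]
  have hk : ∀ a, substExp k (negExp B k) a k = -a k := fun a => by
    simp [substExp, h.negExp_self]; ring
  rw [h.form_mutΛ, key, key, form_add_left, form_smul_left, h.form_row, form_add_right,
    form_smul_right, form_antisymm h.skew _ (B k), h.form_row, Pi.add_apply, hk, hk,
    Pi.smul_apply, h.row_self]
  simp only [smul_eq_mul]
  ring

lemma mutΛ_skew (h : IsCompatible B Λ d) (k : ex) : (mutΛ B Λ k).transpose = -mutΛ B Λ k := by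
  simp [mutΛ, Matrix.transpose_mul, h.skew, Matrix.mul_assoc]

lemma mutB_apply_of_ne {k i : ex} {j : Fin n} (hi : i ≠ k) (hj : j ≠ k) :
    mutB B k i j = B i j + max (B i k) 0 * B k j + B i k * max (-B k j) 0 := by
  rw [mutB, if_neg (by tauto), add_assoc]
  congr 1
  apply Int.ediv_eq_of_eq_mul_right (by norm_num)
  rcases le_total (B i k) 0 with h1 | h1 <;> rcases le_total (B k j) 0 with h2 | h2 <;>
    simp [abs_of_nonneg, abs_of_nonpos, h1, h2] <;> ring

lemma mutB_apply_left {k : ex} (j : Fin n) : mutB B k k j = -B k j := by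
  simp [mutB]

lemma mutB_apply_right {k i : ex} : mutB B k i k = -B i k := by
  simp [mutB]

/-- In the old coordinates a mutated row is the old row plus a multiple of `B k`. This gives
compatibility after mutation; and for the right sign choice the multiple vanishes, as used in
`exists_exchangeExps`. -/
lemma substExp_neg_mutB (h : IsCompatible B Λ d) {k i : ex} (hi : i ≠ k) :
    substExp k (negExp B k) (mutB B k i) = B i + max (B i k) 0 • B k := by
  funext j
  by_cases hj : j = k
  · subst hj
    simp [substExp, mutB_apply_right, h.negExp_self, h.row_self]; ring
  · rw [substExp_apply_of_ne hj, mutB_apply_of_ne hi hj, mutB_apply_right]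
    simp [negExp, Pi.single_eq_of_ne hj]

lemma substExp_pos_mutB (h : IsCompatible B Λ d) {k i : ex} (hi : i ≠ k) :
    substExp k (posExp B k) (mutB B k i) = B i + max (-B i k) 0 • B k := by
  have : substExp k (posExp B k) (mutB B k i) =
      substExp k (negExp B k) (mutB B k i) + mutB B k i k • B k := by
    rw [substExp, substExp, posExp_eq, add_sub_right_comm, smul_add, ← add_assoc]
  rw [this, h.substExp_neg_mutB hi, mutB_apply_right, add_assoc, ← add_smul]
  congr 2
  rcases le_total (B i k) 0 with h1 | h1 <;> simp [h1]

lemma substExp_mutB_self (h : IsCompatible B Λ d) {k : ex} (p : Fin n → ℤ) :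
    substExp k p (mutB B k k) = -B k := by
  have : mutB B k k = -B k := funext mutB_apply_left
  rw [this, substExp_of_zero (by simp [h.row_self])]

lemma mutate (h : IsCompatible B Λ d) (k : ex) : IsCompatible (mutB B k) (mutΛ B Λ k) d := by
  refine ⟨h.mutΛ_skew k, h.pos, fun i a => ?_⟩
  rw [h.form_mutΛ]
  have hk : substExp k (negExp B k) a k = -a k := by
    simp [substExp, h.negExp_self]; ring
  by_cases hi : i = k
  · subst hi
    rw [h.substExp_mutB_self, form_neg_left, h.form_row, hk]; ring
  · have hi' : (i : Fin n) ≠ k := fun hc => hi (Subtype.ext hc)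
    rw [h.substExp_neg_mutB hi, form_add_left, form_smul_left, h.form_row, h.form_row, hk,
      substExp_apply_of_ne hi']
    have e := h.row_symm i k
    simp only [negExp, Pi.add_apply, Pi.neg_apply, Pi.single_eq_of_ne hi']
    -- The two corrections, from the row `i` and from the coordinate `i`, agree by `row_symm`.
    have : d i * max (-B k i) 0 = d k * max (B i k) 0 := by
      rw [mul_max_of_nonneg _ _ (h.pos i).le, mul_max_of_nonneg _ _ (h.pos k).le]
      simp only [mul_neg, mul_zero, e, neg_neg]
    linear_combination (a k) * this

end IsCompatible

end Compatible

/-! ### Toric frames and their mutation -/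

section Frame

variable {K : Type*} [Field K] {F : Type*} [DivisionRing F] [Algebra K F] {n : ℕ}

/-- `M` is a toric frame for `Λ`: `M(a) M(b) = v^{Λ(a,b)} M(a+b)`. -/
structure IsFrame (v : Kˣ) (Λ : Matrix (Fin n) (Fin n) ℤ) (M : (Fin n → ℤ) → F) : Prop where
  skew : Λ.transpose = -Λ
  map_zero : M 0 = 1
  map_mul : ∀ a b, M a * M b = v ^ form Λ a b • M (a + b)

namespace IsFrame

variable {v : Kˣ} {Λ : Matrix (Fin n) (Fin n) ℤ} {M : (Fin n → ℤ) → F}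

lemma mul_neg (h : IsFrame v Λ M) (a : Fin n → ℤ) : M a * M (-a) = 1 := by
  rw [h.map_mul, form_neg_right, form_self h.skew]
  simp [h.map_zero]

lemma neg_mul (h : IsFrame v Λ M) (a : Fin n → ℤ) : M (-a) * M a = 1 := by
  simpa using h.mul_neg (-a)

lemma ne_zero (h : IsFrame v Λ M) (a : Fin n → ℤ) : M a ≠ 0 :=
  left_ne_zero_of_mul_eq_one (h.mul_neg a)

lemma map_add (h : IsFrame v Λ M) (a b : Fin n → ℤ) :
    M (a + b) = v ^ (-form Λ a b) • (M a * M b) := by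
  rw [h.map_mul, smul_smul, ← zpow_add, neg_add_cancel, zpow_zero, one_smul]

lemma comm (h : IsFrame v Λ M) (a b : Fin n → ℤ) :
    M a * M b = v ^ (2 * form Λ a b) • (M b * M a) := by
  rw [h.map_mul, h.map_mul, form_antisymm h.skew b a, smul_smul, ← zpow_add, add_comm b a]
  congr 2; ring

lemma map_pow (h : IsFrame v Λ M) (a : Fin n → ℤ) (c : ℕ) : M a ^ c = M ((c : ℤ) • a) := by
  induction c with
  | zero => simp [h.map_zero]
  | succ c ih =>
    rw [pow_succ, ih, h.map_mul, form_smul_left, form_self h.skew]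
    simp [add_smul]

lemma map_zpow (h : IsFrame v Λ M) (a : Fin n → ℤ) (c : ℤ) : M a ^ c = M (c • a) := by
  obtain ⟨c, rfl | rfl⟩ := c.eq_nat_or_neg
  · rw [zpow_natCast, h.map_pow]
  · rw [zpow_neg, zpow_natCast, h.map_pow, neg_smul]
    exact inv_eq_of_mul_eq_one_right (h.mul_neg _)

lemma prod_ofFn (h : IsFrame v Λ M) {m : ℕ} (g : Fin m → Fin n → ℤ) :
    (List.ofFn fun i => M (g i)).prod =
      v ^ (∑ i, ∑ j, if i < j then form Λ (g i) (g j) else 0) • M (∑ i, g i) := by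
  induction m with
  | zero => simp [h.map_zero]
  | succ m ih =>
    rw [List.ofFn_succ, List.prod_cons, ih, mul_smul_comm, h.map_mul, smul_smul, ← zpow_add,
      Fin.sum_univ_succ g]
    congr 2
    have hs : ∀ s : Finset (Fin m),
        form Λ (g 0) (∑ i ∈ s, g i.succ) = ∑ i ∈ s, form Λ (g 0) (g i.succ) := fun s => by
      induction s using Finset.induction_on with
      | empty => simp [form_zero_right]
      | insert a s ha ih => simp [Finset.sum_insert ha, form_add_right, ih]
    rw [hs, add_comm, Fin.sum_univ_succ]
    simp [Fin.sum_univ_succ]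

variable {ex : Finset (Fin n)}

/-- The normalizing power of `v` is the inverse of the one produced by multiplying the `x_i^{c_i}`
in order, so seeds can be studied through an abstract frame. -/
lemma frame_eq {s : SeedData F ex} (h : IsFrame v s.Λ M) (hx : ∀ i, s.x i = M (Pi.single i 1))
    (c : Fin n → ℤ) : s.frame v c = M c := by
  have h1 : (fun i => s.x i ^ c i) = fun i => M (c i • Pi.single i 1) := by
    funext i; rw [hx, h.map_zpow]
  have h2 : ∑ i, c i • (Pi.single i 1 : Fin n → ℤ) = c := by
    funext j
    simp [Finset.sum_apply, Pi.single_apply]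
  rw [SeedData.frame, h1, ← Units.smul_def, h.prod_ofFn, h2, smul_smul, ← zpow_add,
    ← Finset.sum_add_distrib, Finset.sum_eq_zero, zpow_zero, one_smul]
  intro i _
  rw [← Finset.sum_add_distrib]
  refine Finset.sum_eq_zero fun j _ => ?_
  split_ifs
  · rw [form_smul_left, form_smul_right, form_single_single]
    have := congrFun (congrFun h.skew i) j
    simp only [Matrix.transpose_apply, Matrix.neg_apply] at this
    rw [this]; ring
  · simp

end IsFrame

/-- The toric frame obtained from `M` on replacing `M(e_k)` by `y`. -/
noncomputable def mutFrame (v : Kˣ) (Λ' : Matrix (Fin n) (Fin n) ℤ) (M : (Fin n → ℤ) → F)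
    (k : Fin n) (y : F) (a : Fin n → ℤ) : F :=
  v ^ (-(a k * form Λ' (a - a k • Pi.single k 1) (Pi.single k 1))) •
    (M (a - a k • Pi.single k 1) * y ^ a k)

lemma mutFrame_of_zero (v : Kˣ) (Λ' : Matrix (Fin n) (Fin n) ℤ) (M : (Fin n → ℤ) → F)
    {k : Fin n} (y : F) {a : Fin n → ℤ} (ha : a k = 0) : mutFrame v Λ' M k y a = M a := by
  simp [mutFrame, ha]

lemma zpow_mul_of_quasicomm {v : Kˣ} {y z : F} (hy : y ≠ 0) {e : ℤ}
    (h : y * z = v ^ e • (z * y)) (c : ℤ) : y ^ c * z = v ^ (c * e) • (z * y ^ c) := by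
  have hinv : y⁻¹ * z = v ^ (-e) • (z * y⁻¹) := by
    rw [← mul_right_inj' hy, mul_inv_cancel_left₀ hy, mul_smul_comm, ← mul_assoc, h,
      smul_mul_assoc, smul_smul, ← zpow_add, neg_add_cancel, zpow_zero, one_smul,
      mul_inv_cancel_right₀ hy]
  induction c using Int.induction_on with
  | zero => simp
  | succ c ih =>
    rw [zpow_add₀ hy, zpow_one, mul_assoc, h, mul_smul_comm, ← mul_assoc, ih, smul_mul_assoc,
      smul_smul, ← zpow_add, mul_assoc]
    congr 2; ring
  | pred c ih =>
    rw [zpow_sub₀ hy, zpow_one, div_eq_mul_inv, mul_assoc, hinv, mul_smul_comm, ← mul_assoc, ih,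
      smul_mul_assoc, smul_smul, ← zpow_add, mul_assoc]
    congr 2; ring

/-- Split each exponent into a part free of `e_k` and a multiple of `e_k`; the product rule then
only requires moving powers of `y` past monomials without `x_k`. -/
lemma isFrame_mutFrame {v : Kˣ} {Λ Λ' : Matrix (Fin n) (Fin n) ℤ} {M : (Fin n → ℤ) → F}
    (h : IsFrame v Λ M) (hΛ' : Λ'.transpose = -Λ') {k : Fin n} {y : F} (hy : y ≠ 0)
    (hform : ∀ a b, a k = 0 → b k = 0 → form Λ' a b = form Λ a b)
    (hcomm : ∀ a, a k = 0 → y * M a = v ^ (2 * form Λ' (Pi.single k 1) a) • (M a * y)) :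
    IsFrame v Λ' (mutFrame v Λ' M k y) := by
  refine ⟨hΛ', by simp [mutFrame, h.map_zero], fun a b => ?_⟩
  set e : Fin n → ℤ := Pi.single k 1 with he
  have hek : e k = 1 := by simp [he]
  obtain ⟨a', c, ha, rfl⟩ : ∃ a' : Fin n → ℤ, ∃ c : ℤ, a' k = 0 ∧ a = a' + c • e :=
    ⟨a - a k • e, a k, by simp [hek], by abel⟩
  obtain ⟨b', d, hb, rfl⟩ : ∃ b' : Fin n → ℤ, ∃ d : ℤ, b' k = 0 ∧ b = b' + d • e :=
    ⟨b - b k • e, b k, by simp [hek], by abel⟩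
  have key : ∀ (s : Fin n → ℤ) (c : ℤ), s k = 0 →
      mutFrame v Λ' M k y (s + c • e) = v ^ (-(c * form Λ' s e)) • (M s * y ^ c) := by
    intro s c hs
    have h1 : (s + c • e) k = c := by simp [hs, hek]
    rw [mutFrame, h1, ← he, add_sub_cancel_right]
  have h2 : a' + c • e + (b' + d • e) = (a' + b') + (c + d) • e := by
    rw [add_smul]; abel
  rw [h2, key _ _ ha, key _ _ hb, key _ _ (by simp [ha, hb])]
  have h3 : M a' * y ^ c * (M b' * y ^ d) =
      v ^ (c * (2 * form Λ' e b') + form Λ' a' b') • (M (a' + b') * y ^ (c + d)) := by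
    rw [mul_assoc, ← mul_assoc (y ^ c), zpow_mul_of_quasicomm hy (hcomm b' hb), smul_mul_assoc,
      mul_smul_comm, mul_assoc, ← zpow_add₀ hy, ← mul_assoc (M a'), h.map_mul, smul_mul_assoc,
      smul_smul, ← zpow_add, hform _ _ ha hb]
  rw [smul_mul_assoc, mul_smul_comm, h3]
  simp only [smul_smul, ← zpow_add]
  congr 2
  simp only [form_add_left, form_add_right, form_smul_left, form_smul_right, form_self hΛ']
  rw [form_antisymm hΛ' b' e]
  ring

end Frame

/-! ### Separating eigenvectors -/

section Eigen

open Polynomial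

variable {K : Type*} [Field K]

/-- The vectors annihilated by some `q(φ)` with `q(c) ≠ 0`. -/
def awayFrom {V : Type*} [AddCommGroup V] [Module K V] (φ : Module.End K V) (c : K) :
    Submodule K V where
  carrier := {x | ∃ q : K[X], q.eval c ≠ 0 ∧ aeval φ q x = 0}
  zero_mem' := ⟨1, by simp, by simp⟩
  add_mem' := by
    rintro x y ⟨q, hq, hx⟩ ⟨q', hq', hy⟩
    refine ⟨q * q', by simp [hq, hq'], ?_⟩
    rw [_root_.map_add, _root_.map_mul, Module.End.mul_apply, Module.End.mul_apply, hy,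
      _root_.map_zero, add_zero, ← Module.End.mul_apply, ← _root_.map_mul, mul_comm,
      _root_.map_mul, Module.End.mul_apply, hx, _root_.map_zero]
  smul_mem' := by
    rintro r x ⟨q, hq, hx⟩
    exact ⟨q, hq, by rw [map_smul, hx, smul_zero]⟩

lemma mem_awayFrom_of_eigen {V : Type*} [AddCommGroup V] [Module K V] {φ : Module.End K V}
    {c c' : K} (hc : c' ≠ c) {x : V} (hx : φ x = c' • x) : x ∈ awayFrom φ c :=
  ⟨X - C c', by simpa [sub_eq_zero] using hc.symm, by simp [hx, Module.algebraMap_end_apply]⟩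

lemma aeval_apply_of_eigen {V : Type*} [AddCommGroup V] [Module K V] {φ : Module.End K V}
    {c : K} {x : V} (hx : φ x = c • x) (q : K[X]) : aeval φ q x = q.eval c • x := by
  induction q using Polynomial.induction_on' with
  | add p q hp hq => simp [hp, hq, add_smul]
  | monomial m r =>
    have : ∀ m : ℕ, (φ ^ m) x = c ^ m • x := fun m => by
      induction m with
      | zero => simp
      | succ m ih => rw [pow_succ', Module.End.mul_apply, ih, map_smul, hx, smul_smul, pow_succ]
    simp [aeval_monomial, this, smul_smul, Module.algebraMap_end_apply, mul_comm]

lemma aeval_mem_of_stable {V : Type*} [AddCommGroup V] [Module K V] {φ : Module.End K V}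
    {U : Submodule K V} (hU : ∀ z ∈ U, φ z ∈ U) {z : V} (hz : z ∈ U) (q : K[X]) :
    aeval φ q z ∈ U := by
  induction q using Polynomial.induction_on' with
  | add p q hp hq => simpa using U.add_mem hp hq
  | monomial m r =>
    have : ∀ m : ℕ, (φ ^ m) z ∈ U := fun m => by
      induction m with
      | zero => simpa
      | succ m ih => rw [pow_succ', Module.End.mul_apply]; exact hU _ ih
    simpa [aeval_monomial, Module.algebraMap_end_apply] using U.smul_mem r (this m)

/-- Apply `q(φ)` with `q` killing `y`: it multiplies `x` by the nonzero scalar `q(c)`. -/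
lemma mem_of_add_mem {V : Type*} [AddCommGroup V] [Module K V] {φ : Module.End K V}
    {U : Submodule K V} (hU : ∀ z ∈ U, φ z ∈ U) {c : K} {x y : V} (hx : φ x = c • x)
    (hy : y ∈ awayFrom φ c) (hxy : x + y ∈ U) : x ∈ U := by
  obtain ⟨q, hq, hy⟩ := hy
  have := aeval_mem_of_stable hU hxy q
  rw [_root_.map_add, hy, add_zero, aeval_apply_of_eigen hx] at this
  exact (U.smul_mem_iff hq).1 this

/-- If `g` and `h` shift the `φ`-degree by `A < B` and `g` is invertible in `U`, then an element
decomposing into eigenvectors belongs to `U` as soon as its product with `g + h` does. -/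
lemma sum_mem_of_mul_sum_mem {R : Type*} [Ring R] [Algebra K R] {φ : Module.End K R}
    {c : ℤ → K} (hc : Function.Injective c) {U : Subalgebra K R} (hU : ∀ z ∈ U, φ z ∈ U)
    {g g' h : R} (hg : g ∈ U) (hg' : g' ∈ U) (hgg : g' * g = 1) (hh : h ∈ U) {A B : ℤ}
    (hAB : A < B) (hA : ∀ d z, φ z = c d • z → φ (g * z) = c (d + A) • (g * z))
    (hB : ∀ d z, φ z = c d • z → φ (h * z) = c (d + B) • (h * z)) (s : Finset ℤ) (f : ℤ → R)
    (hf : ∀ d, φ (f d) = c d • f d) (hmem : (g + h) * ∑ d ∈ s, f d ∈ U) :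
    ∑ d ∈ s, f d ∈ U := by
  induction s using Finset.induction_on_min with
  | empty => simp
  | insert a s has ih =>
    have hnot : a ∉ s := fun ha => lt_irrefl _ (has a ha)
    rw [Finset.sum_insert hnot] at hmem ⊢
    -- With `a` the lowest degree, `g * f a` is the only term of degree `a + A`; all others have
    -- larger degree and lie in `awayFrom`.
    have hfa : g * f a ∈ U := by
      have e : (g + h) * (f a + ∑ d ∈ s, f d) =
          g * f a + (h * f a + ∑ d ∈ s, (g * f d + h * f d)) := by
        rw [Finset.sum_add_distrib, ← Finset.mul_sum, ← Finset.mul_sum]; noncomm_ring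
      rw [e] at hmem
      refine mem_of_add_mem (U := Subalgebra.toSubmodule U) hU (hA a _ (hf a)) ?_ hmem
      refine Submodule.add_mem _ (mem_awayFrom_of_eigen (hc.ne (by omega)) (hB a _ (hf a)))
        (Submodule.sum_mem _ fun d hd => ?_)
      have := has d hd
      exact Submodule.add_mem _ (mem_awayFrom_of_eigen (hc.ne (by omega)) (hA d _ (hf d)))
        (mem_awayFrom_of_eigen (hc.ne (by omega)) (hB d _ (hf d)))
    have hfa' : f a ∈ U := by
      have := U.mul_mem hg' hfa
      rwa [← mul_assoc, hgg, one_mul] at this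
    refine U.add_mem hfa' (ih ?_)
    rw [mul_add] at hmem
    exact (add_mem_cancel_left (U.mul_mem (U.add_mem hg hh) hfa')).1 hmem

end Eigen

/-! ### The Laurent phenomenon -/

section Laurent

variable {K : Type*} [Field K] {F : Type*} [DivisionRing F] [Algebra K F]
variable {n : ℕ} {ex : Finset (Fin n)}

lemma units_smul_mem {V : Type*} [AddCommGroup V] [Module K V] (U : Submodule K V) (u : Kˣ)
    {z : V} : u • z ∈ U ↔ z ∈ U := by
  rw [Units.smul_def]
  exact U.smul_mem_iff u.ne_zero

lemma units_smul_mem_alg {V : Type*} [Ring V] [Algebra K V] (U : Subalgebra K V) (u : Kˣ)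
    {z : V} : u • z ∈ U ↔ z ∈ U :=
  units_smul_mem (Subalgebra.toSubmodule U) u

/-- A seed with a toric frame `M` and a compatible pair `(B, Λ)`. -/
structure IsValid (v : Kˣ) (s : SeedData F ex) (d : ex → ℤ) (M : (Fin n → ℤ) → F) : Prop where
  compat : IsCompatible s.B s.Λ d
  frame : IsFrame v s.Λ M
  x_eq : ∀ i, s.x i = M (Pi.single i 1)

section Mutation

variable {v : Kˣ} {d : ex → ℤ} {B : Matrix ex (Fin n) ℤ} {Λ : Matrix (Fin n) (Fin n) ℤ}
  {M M' : (Fin n → ℤ) → F} {k : ex}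

lemma IsCompatible.form_exp_eq (h : IsCompatible B Λ d) {a : Fin n → ℤ} (ha : a k = 0) :
    form Λ (posExp B k) a = form Λ (negExp B k) a := by
  rw [posExp_eq, form_add_left, h.form_row, ha]; ring

lemma IsCompatible.form_mutΛ_single_left (h : IsCompatible B Λ d) {a : Fin n → ℤ}
    (ha : a k = 0) :
    form (IsCompatible.mutΛ B Λ k) (Pi.single (k : Fin n) 1) a = form Λ (negExp B k) a := by
  rw [h.form_mutΛ, substExp_single, substExp_of_zero ha]

/-- The two monomials commute with `x_k` up to different powers of `v`, since their exponents differ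
by `B k` and `d k > 0`; hence they cannot cancel. -/
lemma exchange_ne_zero (hv : ∀ m : ℕ, 0 < m → v ^ m ≠ 1) (h : IsCompatible B Λ d)
    (hM : IsFrame v Λ M) : M (posExp B k) + M (negExp B k) ≠ 0 := by
  intro h0
  have h1 : M (posExp B k) = -M (negExp B k) := eq_neg_of_add_eq_zero_left h0
  set e : Fin n → ℤ := Pi.single (k : Fin n) 1 with he
  have h2 := hM.comm e (posExp B k)
  rw [h1, mul_neg, neg_mul, smul_neg, neg_inj, hM.comm e (negExp B k)] at h2
  have h3 : M (negExp B k) * M e ≠ 0 := mul_ne_zero (hM.ne_zero _) (hM.ne_zero _)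
  rw [Units.smul_def, Units.smul_def] at h2
  have h4 := zpow_inj_of_not_root hv (Units.ext (smul_left_injective K h3 h2))
  rw [posExp_eq, form_add_right, form_antisymm h.skew e (B k), h.form_row] at h4
  have := h.pos k
  simp [he] at h4
  omega

lemma exists_mutFrame (hv : ∀ m : ℕ, 0 < m → v ^ m ≠ 1) (h : IsCompatible B Λ d)
    (hM : IsFrame v Λ M) (k : ex) :
    ∃ M' : (Fin n → ℤ) → F, IsFrame v (IsCompatible.mutΛ B Λ k) M' ∧
      (∀ a : Fin n → ℤ, a k = 0 → M' a = M a) ∧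
      M' (Pi.single (k : Fin n) 1) = M (posExp B k) + M (negExp B k) := by
  refine ⟨mutFrame v (IsCompatible.mutΛ B Λ k) M k (M (posExp B k) + M (negExp B k)),
    isFrame_mutFrame hM (h.mutΛ_skew k) (exchange_ne_zero hv h hM) ?_ ?_,
    fun a ha => mutFrame_of_zero _ _ _ _ ha, ?_⟩
  · intro a b ha hb
    rw [h.form_mutΛ, substExp_of_zero ha, substExp_of_zero hb]
  · intro a ha
    rw [add_mul, hM.comm, hM.comm (negExp B k), h.form_exp_eq ha, h.form_mutΛ_single_left ha,
      ← smul_add, mul_add]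
  · simp [mutFrame, hM.map_zero, form_zero_left]

/-- The exchange relation read backwards. -/
lemma exchange_symm (h : IsCompatible B Λ d) (hM : IsFrame v Λ M)
    (hM' : IsFrame v (IsCompatible.mutΛ B Λ k) M')
    (hMM' : ∀ a : Fin n → ℤ, a k = 0 → M' a = M a)
    (hk : M' (Pi.single (k : Fin n) 1) = M (posExp B k) + M (negExp B k)) :
    M' (posExp (mutB B k) k) + M' (negExp (mutB B k) k) = M (Pi.single (k : Fin n) 1) := by
  set e : Fin n → ℤ := Pi.single (k : Fin n) 1 with he
  set P : Fin n → ℤ := fun i => max (B k i) 0 with hP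
  set N : Fin n → ℤ := fun i => max (-B k i) 0 with hN
  have hPk : P k = 0 := by simp [hP, h.row_self]
  have hNk : N k = 0 := by simp [hN, h.row_self]
  have hp : posExp B k = -e + P := rfl
  have hn : negExp B k = -e + N := rfl
  have hp' : posExp (mutB B k) k = -e + N := by
    funext i; simp [posExp, IsCompatible.mutB_apply_left, he, hN]
  have hn' : negExp (mutB B k) k = -e + P := by
    funext i; simp [negExp, IsCompatible.mutB_apply_left, he, hP]
  have e1 : form (IsCompatible.mutΛ B Λ k) N e = form Λ e N := by
    rw [h.form_mutΛ, he, substExp_single, substExp_of_zero hNk, hn, form_add_right,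
      form_self h.skew, form_neg_right, ← form_antisymm h.skew, add_zero]
  -- The expression of the mutated form through `posExp` makes this the mirror image of `e1`.
  have e2 : form (IsCompatible.mutΛ B Λ k) P e = form Λ e P := by
    rw [h.form_mutΛ', he, substExp_single, substExp_of_zero hPk, hp, form_add_right,
      form_self h.skew, form_neg_right, ← form_antisymm h.skew, add_zero]
  -- After multiplication by the new variable, both sides are combinations of `M N` and `M P`, with
  -- equal powers of `v` by `e1` and `e2`.
  refine mul_right_cancel₀ (hM'.ne_zero e) ?_
  rw [hp', hn', add_mul, hM'.map_mul, hM'.map_mul, hk, hp, hn, mul_add, hM.map_mul, hM.map_mul]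
  have h0 : ∀ s : Fin n → ℤ, -e + s + e = s := fun s => by abel
  have h1 : ∀ s : Fin n → ℤ, e + (-e + s) = s := fun s => by abel
  rw [h0, h0, h1, h1, hMM' _ hNk, hMM' _ hPk, form_add_left, form_add_left, form_neg_left, e1, e2,
    form_self hM'.skew, form_add_right, form_add_right, form_neg_right, form_self h.skew]
  simp [add_comm]

lemma IsValid.exists_mutate (hv : ∀ m : ℕ, 0 < m → v ^ m ≠ 1) {s : SeedData F ex}
    (h : IsValid v s d M) (k : ex) :
    ∃ M' : (Fin n → ℤ) → F, IsValid v (s.mutate v k) d M' ∧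
      (∀ a : Fin n → ℤ, a k = 0 → M' a = M a) ∧
      M' (Pi.single (k : Fin n) 1) = M (posExp s.B k) + M (negExp s.B k) := by
  obtain ⟨M', hM', h1, h2⟩ := exists_mutFrame hv h.compat h.frame k
  refine ⟨M', ⟨h.compat.mutate k, hM', fun i => ?_⟩, h1, h2⟩
  by_cases hi : i = k
  · subst hi
    rw [h2]
    simp only [SeedData.mutate, Function.update_self, h.frame.frame_eq h.x_eq]
    rfl
  · rw [h1 _ (by simp [Ne.symm hi])]
    simp [SeedData.mutate, Function.update_of_ne hi, h.x_eq]

/-- The algebra generated by `x_i^{±1}` (`i ≠ j`), `x_j` and the variable `x_j'` obtained by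
mutation in direction `j`. -/
noncomputable def exchAlg (K : Type*) [Field K] [Algebra K F] (B : Matrix ex (Fin n) ℤ)
    (M : (Fin n → ℤ) → F) (j : ex) : Subalgebra K F :=
  Algebra.adjoin K ({z | ∃ a : Fin n → ℤ, 0 ≤ a j ∧ z = M a} ∪
    {M (posExp B j) + M (negExp B j)})

lemma mem_exchAlg {j : ex} {a : Fin n → ℤ} (ha : 0 ≤ a j) : M a ∈ exchAlg K B M j :=
  Algebra.subset_adjoin (Or.inl ⟨a, ha, rfl⟩)

lemma exchange_mem_exchAlg (j : ex) :
    M (posExp B j) + M (negExp B j) ∈ exchAlg K B M j :=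
  Algebra.subset_adjoin (Or.inr rfl)

/-- Multiply the mutated variable by a monomial free of `x_j`: both of its terms acquire the same
power of `v`, because `B j` pairs to zero with exponents free of `x_j`. -/
lemma binomial_mem_exchAlg (h : IsCompatible B Λ d) (hM : IsFrame v Λ M) {j : ex}
    {a : Fin n → ℤ} (ha : a j = -1) : M (a + B j) + M a ∈ exchAlg K B M j := by
  set s := a - negExp B j with hs
  have hsj : s j = 0 := by simp [hs, ha, h.negExp_self]
  have h1 : M s * (M (posExp B j) + M (negExp B j)) ∈ exchAlg K B M j :=
    Subalgebra.mul_mem _ (mem_exchAlg hsj.ge) (exchange_mem_exchAlg j)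
  have h2 : form Λ s (posExp B j) = form Λ s (negExp B j) := by
    rw [form_antisymm h.skew, h.form_exp_eq hsj, ← form_antisymm h.skew]
  rw [mul_add, hM.map_mul, hM.map_mul, h2, ← smul_add] at h1
  have h3 : s + posExp B j = a + B j := by rw [posExp_eq, hs]; abel
  have h4 : s + negExp B j = a := by rw [hs]; abel
  rw [h3, h4] at h1
  exact (units_smul_mem_alg _ _).1 h1

lemma mul_mem_span_range (hM : IsFrame v Λ M) {y z : F}
    (hy : y ∈ Submodule.span K (Set.range M)) (hz : z ∈ Submodule.span K (Set.range M)) :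
    y * z ∈ Submodule.span K (Set.range M) := by
  induction hy, hz using Submodule.span_induction₂ with
  | mem_mem x y hx hy =>
    obtain ⟨a, rfl⟩ := hx
    obtain ⟨b, rfl⟩ := hy
    rw [hM.map_mul, units_smul_mem]
    exact Submodule.subset_span ⟨_, rfl⟩
  | zero_left => simp
  | zero_right => simp
  | add_left _ _ _ _ _ _ h1 h2 => rw [add_mul]; exact Submodule.add_mem _ h1 h2
  | add_right _ _ _ _ _ _ h1 h2 => rw [mul_add]; exact Submodule.add_mem _ h1 h2
  | smul_left r _ _ _ _ h => rw [smul_mul_assoc]; exact Submodule.smul_mem _ r h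
  | smul_right r _ _ _ _ h => rw [mul_smul_comm]; exact Submodule.smul_mem _ r h

lemma adjoin_range_le_span (hM : IsFrame v Λ M) {z : F}
    (hz : z ∈ Algebra.adjoin K (Set.range M)) : z ∈ Submodule.span K (Set.range M) := by
  induction hz using Algebra.adjoin_induction with
  | mem x hx => exact Submodule.subset_span hx
  | algebraMap r =>
    rw [Algebra.algebraMap_eq_smul_one, ← hM.map_zero]
    exact Submodule.smul_mem _ r (Submodule.subset_span ⟨0, rfl⟩)
  | add x y _ _ hx hy => exact Submodule.add_mem _ hx hy
  | mul x y _ _ hx hy => exact mul_mem_span_range hM hx hy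

lemma exchAlg_le_adjoin_range (j : ex) : exchAlg K B M j ≤ Algebra.adjoin K (Set.range M) := by
  refine Algebra.adjoin_le ?_
  rintro z (⟨a, -, rfl⟩ | rfl)
  · exact Algebra.subset_adjoin ⟨a, rfl⟩
  · exact Subalgebra.add_mem _ (Algebra.subset_adjoin ⟨_, rfl⟩) (Algebra.subset_adjoin ⟨_, rfl⟩)

lemma mutFrame_eq_smul (hM' : IsFrame v (IsCompatible.mutΛ B Λ k) M')
    (hMM' : ∀ a : Fin n → ℤ, a k = 0 → M' a = M a) (a : Fin n → ℤ) :
    ∃ u : Kˣ, M' a = u • (M (a - a k • Pi.single (k : Fin n) 1) *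
      M' (Pi.single (k : Fin n) 1) ^ a k) := by
  set e : Fin n → ℤ := Pi.single (k : Fin n) 1 with he
  refine ⟨v ^ (-form (IsCompatible.mutΛ B Λ k) (a - a k • e) (a k • e)), ?_⟩
  rw [hM'.map_zpow, ← hMM' _ (by simp [he]), ← hM'.map_add]
  congr 1; abel

/-- The exchange algebra in the direction of the mutation can only grow. -/
lemma exchAlg_mutate_le_self (h : IsCompatible B Λ d) (hM : IsFrame v Λ M)
    (hM' : IsFrame v (IsCompatible.mutΛ B Λ k) M')
    (hMM' : ∀ a : Fin n → ℤ, a k = 0 → M' a = M a)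
    (hk : M' (Pi.single (k : Fin n) 1) = M (posExp B k) + M (negExp B k)) :
    exchAlg K (mutB B k) M' k ≤ exchAlg K B M k := by
  refine Algebra.adjoin_le ?_
  rintro z (⟨a, ha, rfl⟩ | rfl)
  · obtain ⟨u, hu⟩ := mutFrame_eq_smul hM' hMM' a
    rw [hu, hk]
    refine (units_smul_mem_alg _ _).2 (Subalgebra.mul_mem _ ?_ ?_)
    · exact mem_exchAlg (by simp)
    · obtain ⟨c, hc⟩ := Int.eq_ofNat_of_zero_le ha
      rw [hc, zpow_natCast]
      exact Subalgebra.pow_mem _ (exchange_mem_exchAlg k) c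
  · rw [exchange_symm h hM hM' hMM' hk]
    exact mem_exchAlg (by simp)

end Mutation

end Laurent

/-! ### Upper bounds under a single mutation -/

section Laurent

variable {K : Type*} [Field K] {F : Type*} [DivisionRing F] [Algebra K F]
variable {n : ℕ} {ex : Finset (Fin n)}
variable {v : Kˣ} {d : ex → ℤ} {B : Matrix ex (Fin n) ℤ} {Λ : Matrix (Fin n) (Fin n) ℤ}
  {M M' : (Fin n → ℤ) → F} {k j : ex}

lemma pow_mul_of_quasicomm {y z : F} (hy : y ≠ 0) {e : ℤ}
    (h : y * z = v ^ e • (z * y)) (c : ℕ) : y ^ c * z = v ^ (c * e) • (z * y ^ c) := by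
  have := zpow_mul_of_quasicomm hy h c
  rwa [zpow_natCast] at this

lemma exists_pow_mul_mem_of_adjoin {U : Subalgebra K F} {y : F} (hy : y ≠ 0) (hyU : y ∈ U)
    {s : Set F} (hs : ∀ z ∈ s, (∃ e : ℤ, y * z = v ^ e • (z * y)) ∧ ∃ N : ℕ, y ^ N * z ∈ U)
    {f : F} (hf : f ∈ Algebra.adjoin K s) : ∃ N : ℕ, y ^ N * f ∈ U := by
  -- Quasi-commutation with `y` passes to products but not to sums, so `f` is first written as a
  -- combination of products of generators.
  rw [← Subalgebra.mem_toSubmodule, Algebra.adjoin_eq_span] at hf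
  induction hf using Submodule.span_induction with
  | mem x hx =>
    suffices (∃ e : ℤ, y * x = v ^ e • (x * y)) ∧ ∃ N : ℕ, y ^ N * x ∈ U from this.2
    induction hx using Submonoid.closure_induction with
    | mem x hx => exact hs x hx
    | one => exact ⟨⟨0, by simp⟩, 0, by simp⟩
    | mul a b _ _ ha hb =>
      obtain ⟨⟨e, he⟩, N, hN⟩ := ha
      obtain ⟨⟨e', he'⟩, N', hN'⟩ := hb
      refine ⟨⟨e + e', ?_⟩, N + N', ?_⟩
      · rw [← mul_assoc, he, smul_mul_assoc, mul_assoc, he', mul_smul_comm, smul_smul,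
          ← zpow_add, mul_assoc]
      · rw [pow_add, mul_assoc, ← mul_assoc (y ^ N'), pow_mul_of_quasicomm hy he,
          smul_mul_assoc, mul_smul_comm, units_smul_mem_alg, mul_assoc, ← mul_assoc]
        exact U.mul_mem hN hN'
  | zero => exact ⟨0, by simp⟩
  | add a b _ _ ha hb =>
    obtain ⟨N, hN⟩ := ha
    obtain ⟨N', hN'⟩ := hb
    refine ⟨N + N', ?_⟩
    rw [mul_add]
    refine U.add_mem ?_ ?_
    · rw [add_comm, pow_add, mul_assoc]
      exact U.mul_mem (U.pow_mem hyU _) hN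
    · rw [pow_add, mul_assoc]
      exact U.mul_mem (U.pow_mem hyU _) hN'
  | smul r a _ ha =>
    obtain ⟨N, hN⟩ := ha
    exact ⟨N, by rw [mul_smul_comm]; exact U.smul_mem hN r⟩

section Grading

variable {φ : Module.End K F}

/-- Decomposition of an element of the quantum torus into eigenvectors of a diagonal operator. -/
lemma exists_eigen_decomposition {c : ℤ → K} {deg : (Fin n → ℤ) → ℤ}
    (hφ : ∀ a, φ (M a) = c (deg a) • M a) {f : F} (hf : f ∈ Submodule.span K (Set.range M)) :
    ∃ (s : Finset ℤ) (g : ℤ → F), (∀ d, φ (g d) = c d • g d) ∧ f = ∑ d ∈ s, g d := by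
  obtain ⟨l, rfl⟩ := Finsupp.mem_span_range_iff_exists_finsupp.1 hf
  refine ⟨l.support.image deg, fun d => ∑ a ∈ l.support with deg a = d, l a • M a, fun d => ?_, ?_⟩
  · rw [_root_.map_sum, Finset.smul_sum]
    refine Finset.sum_congr rfl fun a ha => ?_
    rw [map_smul, hφ, (Finset.mem_filter.1 ha).2, smul_comm]
  · rw [Finset.sum_fiberwise_of_maps_to fun a ha => Finset.mem_image_of_mem deg ha]
    rfl

/-- Conjugation by `M e` preserves `U` and grades the quantum torus; `M p`, invertible in `U`, and
`M p'` have different degrees, so `sum_mem_of_mul_sum_mem` cancels the binomial. -/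
lemma mem_of_mul_mem (hv : ∀ m : ℕ, 0 < m → v ^ m ≠ 1) (hM : IsFrame v Λ M)
    {U : Subalgebra K F} {e p p' : Fin n → ℤ} (he : M e ∈ U) (he' : M (-e) ∈ U)
    (hp : M p ∈ U) (hp' : M (-p) ∈ U) (hq : M p' ∈ U) (hne : form Λ e p ≠ form Λ e p') {f : F}
    (hf : f ∈ Submodule.span K (Set.range M)) (hmem : (M p + M p') * f ∈ U) : f ∈ U := by
  -- The sign `σ` orients the grading so that the invertible monomial `M p` has the lower degree.
  obtain ⟨σ, hσ, hlt⟩ : ∃ σ : ℤ, σ * σ = 1 ∧ σ * form Λ e p < σ * form Λ e p' := by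
    rcases lt_or_gt_of_ne hne with h | h
    · exact ⟨1, rfl, by omega⟩
    · exact ⟨-1, rfl, by omega⟩
  set φ : Module.End K F := LinearMap.mulRight K (M (-e)) ∘ₗ LinearMap.mulLeft K (M e) with hφ
  have hφa : ∀ z, φ z = M e * z * M (-e) := fun z => rfl
  set c : ℤ → K := fun d => ((v ^ (2 * σ * d) : Kˣ) : K) with hc
  have hcinj : Function.Injective c := by
    intro x y hxy
    have h1 := zpow_inj_of_not_root hv (Units.ext hxy)
    have h2 : σ ≠ 0 := by rintro rfl; simp at hσ
    have h3 : 2 * σ ≠ 0 := by omega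
    exact mul_left_cancel₀ h3 h1
  have hcadd : ∀ x y, c (x + y) = c y * c x := fun x y => by
    simp only [hc]; rw [← Units.val_mul, ← zpow_add]; congr 2; ring
  have hφM : ∀ a, φ (M a) = c (σ * form Λ e a) • M a := fun a => by
    rw [hφa, hM.comm, smul_mul_assoc, mul_assoc, hM.mul_neg, mul_one, Units.smul_def]
    simp only [hc]
    congr 3
    linear_combination (-2 * form Λ e a) * hσ
  have hφmul : ∀ y z, φ (y * z) = φ y * φ z := fun y z => by
    simp only [hφa, mul_assoc]
    rw [← mul_assoc (M (-e)) (M e), hM.neg_mul, one_mul]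
  obtain ⟨s, g, hg, rfl⟩ := exists_eigen_decomposition hφM hf
  refine sum_mem_of_mul_sum_mem (φ := φ) hcinj (fun z hz => ?_) hp hp' (hM.neg_mul p) hq hlt ?_ ?_
    s g hg hmem
  · exact U.mul_mem (U.mul_mem he hz) he'
  · intro d z hz
    rw [hφmul, hφM, hz, smul_mul_smul_comm, ← hcadd]
  · intro d z hz
    rw [hφmul, hφM, hz, smul_mul_smul_comm, ← hcadd]

lemma mem_of_pow_mul_mem (hv : ∀ m : ℕ, 0 < m → v ^ m ≠ 1) (hM : IsFrame v Λ M)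
    {U : Subalgebra K F} {e p p' : Fin n → ℤ} (he : M e ∈ U) (he' : M (-e) ∈ U)
    (hp : M p ∈ U) (hp' : M (-p) ∈ U) (hq : M p' ∈ U) (hne : form Λ e p ≠ form Λ e p') (N : ℕ)
    {f : F} (hf : f ∈ Submodule.span K (Set.range M)) (hmem : (M p + M p') ^ N * f ∈ U) :
    f ∈ U := by
  induction N generalizing f with
  | zero => simpa using hmem
  | succ N ih =>
    refine mem_of_mul_mem hv hM he he' hp hp' hq hne hf (ih (mul_mem_span_range hM ?_ hf) ?_)
    · exact Submodule.add_mem _ (Submodule.subset_span ⟨p, rfl⟩) (Submodule.subset_span ⟨p', rfl⟩)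
    · rwa [← mul_assoc, ← pow_succ]

end Grading

/-- A choice of the two monomials `M(p)`, `M(p')` of the exchange relation in direction `k`,
such that `M(p)` does not involve `x_j`. -/
structure ExchangeExps (B : Matrix ex (Fin n) ℤ) (Λ : Matrix (Fin n) (Fin n) ℤ) (k j : ex)
    (p p' : Fin n → ℤ) : Prop where
  form_eq : ∀ a b, form (IsCompatible.mutΛ B Λ k) a b = form Λ (substExp k p a) (substExp k p b)
  subst_row : substExp k p (mutB B k j) = B j
  apply_eq_zero : p j = 0
  apply_nonneg : 0 ≤ p' j
  eq_zero_of : p' j = 0 → mutB B k j k = 0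
  form_ne : form Λ (Pi.single (k : Fin n) 1) p ≠ form Λ (Pi.single (k : Fin n) 1) p'

/-- The sign of `B k j` decides which monomial avoids `x_j`. As `B j k` has the opposite sign, the
same choice carries the mutated row `j` exactly to `B j`. -/
lemma exists_exchangeExps (h : IsCompatible B Λ d) (hjk : j ≠ k)
    (hk : M' (Pi.single (k : Fin n) 1) = M (posExp B k) + M (negExp B k)) :
    ∃ p p', ExchangeExps B Λ k j p p' ∧ M' (Pi.single (k : Fin n) 1) = M p + M p' := by
  have hjk' : (j : Fin n) ≠ k := fun hc => hjk (Subtype.ext hc)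
  have hne : form Λ (Pi.single (k : Fin n) 1) (posExp B k) ≠
      form Λ (Pi.single (k : Fin n) 1) (negExp B k) := by
    rw [posExp_eq, form_add_right, form_antisymm h.skew _ (B k), h.form_row]
    have := h.pos k
    simp only [Pi.single_eq_same]
    omega
  rcases le_total 0 (B k j) with hkj | hkj
  · have h1 := h.row_symm_nonpos hkj
    refine ⟨negExp B k, posExp B k, ⟨h.form_mutΛ k, ?_, ?_, ?_, fun h0 => ?_, hne.symm⟩, ?_⟩
    · rw [h.substExp_neg_mutB hjk, max_eq_right h1, zero_smul, add_zero]
    · simp [negExp, Pi.single_eq_of_ne hjk', hkj]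
    · simp [posExp, Pi.single_eq_of_ne hjk']
    · simp only [posExp, Pi.add_apply, Pi.neg_apply, Pi.single_eq_of_ne hjk', neg_zero, zero_add,
        max_eq_left hkj] at h0
      rw [IsCompatible.mutB_apply_right, h.row_symm_eq_zero h0, neg_zero]
    · rw [hk, add_comm]
  · have h1 := h.row_symm_nonneg hkj
    refine ⟨posExp B k, negExp B k, ⟨h.form_mutΛ' k, ?_, ?_, ?_, fun h0 => ?_, hne⟩, hk⟩
    · rw [h.substExp_pos_mutB hjk, max_eq_right (by omega), zero_smul, add_zero]
    · simp [posExp, Pi.single_eq_of_ne hjk', hkj]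
    · simp [negExp, Pi.single_eq_of_ne hjk']
    · simp only [negExp, Pi.add_apply, Pi.neg_apply, Pi.single_eq_of_ne hjk', neg_zero, zero_add,
        max_eq_left (neg_nonneg.2 hkj)] at h0
      rw [IsCompatible.mutB_apply_right, h.row_symm_eq_zero (by omega), neg_zero]

section Transport

variable {p p' : Fin n → ℤ}

/-- Every term of the difference of powers has a factor `M p'`, whose positive power of `x_j`
compensates the `x_j^{-1}` in `M a`. -/
lemma mul_pow_sub_pow_mem (hM : IsFrame v Λ M) (hp : p j = 0) (hp' : 1 ≤ p' j)
    {a : Fin n → ℤ} (ha : a j = -1) (c : ℕ) :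
    M a * ((M p + M p') ^ c - M p ^ c) ∈ exchAlg K B M j := by
  induction c with
  | zero => simp
  | succ c ih =>
    have e : M a * ((M p + M p') ^ (c + 1) - M p ^ (c + 1)) =
        M a * ((M p + M p') ^ c - M p ^ c) * (M p + M p') + M a * M p ^ c * M p' := by
      rw [pow_succ, pow_succ]; noncomm_ring
    rw [e]
    refine Subalgebra.add_mem _ (Subalgebra.mul_mem _ ih (Subalgebra.add_mem _
      (mem_exchAlg hp.ge) (mem_exchAlg (by omega)))) ?_
    rw [hM.map_pow, hM.map_mul, smul_mul_assoc, hM.map_mul, units_smul_mem_alg,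
      units_smul_mem_alg]
    exact mem_exchAlg (by simp [ha, hp]; omega)

lemma mutFrame_sub_mem (hM : IsFrame v Λ M) (hM' : IsFrame v (IsCompatible.mutΛ B Λ k) M')
    (hMM' : ∀ a : Fin n → ℤ, a k = 0 → M' a = M a) (hjk : j ≠ k) (E : ExchangeExps B Λ k j p p')
    (hk : M' (Pi.single (k : Fin n) 1) = M p + M p') {a : Fin n → ℤ} (haj : a j = -1)
    (hak : 0 ≤ a k) (ha0 : p' j = 0 → a k = 0) :
    M' a - M (substExp k p a) ∈ exchAlg K B M j := by
  have hjk' : (j : Fin n) ≠ k := fun hc => hjk (Subtype.ext hc)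
  by_cases h0 : a k = 0
  · rw [hMM' a h0, substExp_of_zero h0, sub_self]
    exact Subalgebra.zero_mem _
  have hp'j : 1 ≤ p' j := by
    have := E.apply_nonneg
    rcases this.eq_or_lt with h | h
    · exact absurd (ha0 h.symm) h0
    · omega
  obtain ⟨c, hc⟩ := Int.eq_ofNat_of_zero_le hak
  set e : Fin n → ℤ := Pi.single (k : Fin n) 1 with he
  set a' := a - (c : ℤ) • e with ha'
  have ha'k : a' k = 0 := by simp [ha', he, hc]
  have ha'j : a' j = -1 := by simp [ha', he, haj, Pi.single_eq_of_ne hjk']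
  have haa : a = a' + (c : ℤ) • e := by rw [ha']; abel
  have hcek : ((c : ℤ) • e) k = c := by simp [he]
  have hEa : substExp k p ((c : ℤ) • e) = (c : ℤ) • p := by
    rw [substExp, hcek, smul_sub, ← he]; abel
  have h1 : M' a = v ^ (-form Λ a' ((c : ℤ) • p)) • (M a' * (M p + M p') ^ c) := by
    rw [haa, hM'.map_add, hMM' _ ha'k, ← hM'.map_pow, hk, E.form_eq, substExp_of_zero ha'k, hEa]
  have h2 : M (substExp k p a) = v ^ (-form Λ a' ((c : ℤ) • p)) • (M a' * M p ^ c) := by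
    rw [haa, substExp_add, substExp_of_zero ha'k, hEa, hM.map_add, hM.map_pow]
  rw [h1, h2, ← smul_sub, ← mul_sub, units_smul_mem_alg]
  exact mul_pow_sub_pow_mem hM E.apply_eq_zero hp'j ha'j c

/-- The generators of the mutated exchange algebra enter the old one after multiplication by a power
of `x_k'`; that power is then cancelled, using that `f` is a Laurent polynomial in the old cluster.
-/
lemma exchAlg_mutate_transport (hv : ∀ m : ℕ, 0 < m → v ^ m ≠ 1) (h : IsCompatible B Λ d)
    (hM : IsFrame v Λ M) (hM' : IsFrame v (IsCompatible.mutΛ B Λ k) M')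
    (hMM' : ∀ a : Fin n → ℤ, a k = 0 → M' a = M a)
    (hk : M' (Pi.single (k : Fin n) 1) = M (posExp B k) + M (negExp B k)) (hjk : j ≠ k) {f : F}
    (hf : f ∈ exchAlg K (mutB B k) M' j) (hfM : f ∈ Submodule.span K (Set.range M)) :
    f ∈ exchAlg K B M j := by
  have hjk' : (j : Fin n) ≠ k := fun hc => hjk (Subtype.ext hc)
  have h' := h.mutate k
  obtain ⟨p, p', E, hk⟩ := exists_exchangeExps h hjk hk
  set e : Fin n → ℤ := Pi.single (k : Fin n) 1 with he
  have hej : e j = 0 := by simp [he, Pi.single_eq_of_ne hjk']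
  have hy : M' e ≠ 0 := hM'.ne_zero e
  have hyU : M' e ∈ exchAlg K B M j := by
    rw [hk]
    exact Subalgebra.add_mem _ (mem_exchAlg E.apply_eq_zero.ge) (mem_exchAlg E.apply_nonneg)
  obtain ⟨N, hN⟩ : ∃ N : ℕ, M' e ^ N * f ∈ exchAlg K B M j := by
    refine exists_pow_mul_mem_of_adjoin (v := v) hy hyU ?_ hf
    rintro z (⟨a, ha, rfl⟩ | rfl)
    -- The factor `x_k'^{|a_k|}` makes the exponent of `x_k'` nonnegative.
    · refine ⟨⟨_, hM'.comm _ _⟩, (a k).natAbs, ?_⟩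
      rw [hM'.map_pow, hM'.map_mul, units_smul_mem_alg]
      obtain ⟨u, hu⟩ := mutFrame_eq_smul hM' hMM' (((a k).natAbs : ℤ) • e + a)
      rw [hu, units_smul_mem_alg]
      refine Subalgebra.mul_mem _ (mem_exchAlg ?_) ?_
      · simp [hej, ha, Pi.single_eq_of_ne hjk']
      · have : 0 ≤ (((a k).natAbs : ℤ) • e + a) k := by
          simp [he]; exact neg_le_iff_add_nonneg'.1 (neg_abs_le (a k))
        obtain ⟨c, hc⟩ := Int.eq_ofNat_of_zero_le this
        rw [hc, zpow_natCast]
        exact Subalgebra.pow_mem _ hyU c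
    · refine ⟨⟨2 * form (IsCompatible.mutΛ B Λ k) e (negExp (mutB B k) j), ?_⟩, 0, ?_⟩
      · rw [mul_add, hM'.comm, hM'.comm e (negExp _ _), form_antisymm h'.skew e (posExp _ _),
          h'.form_exp_eq hej, ← form_antisymm h'.skew, ← smul_add, ← add_mul]
      · rw [pow_zero, one_mul]
        have hnj : negExp (mutB B k) j j = -1 := h'.negExp_self j
        have hpj : posExp (mutB B k) j j = -1 := h'.posExp_self j
        have hnk : negExp (mutB B k) j k = max (-mutB B k j k) 0 := by
          simp [negExp, Pi.single_eq_of_ne hjk'.symm]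
        have hpk : posExp (mutB B k) j k = max (mutB B k j k) 0 := by
          simp [posExp, Pi.single_eq_of_ne hjk'.symm]
        have m1 := mutFrame_sub_mem hM hM' hMM' hjk E hk hnj (by rw [hnk]; exact le_max_right _ _)
          (fun h0 => by rw [hnk, E.eq_zero_of h0]; rfl)
        have m2 := mutFrame_sub_mem hM hM' hMM' hjk E hk hpj (by rw [hpk]; exact le_max_right _ _)
          (fun h0 => by rw [hpk, E.eq_zero_of h0]; rfl)
        -- Modulo the old exchange algebra, each monomial of the mutated `x_j'` equals its
        -- substitution by `p`. By `subst_row` the two exponents differ by `B j`, so the sum is a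
        -- binomial already treated.
        have m3 : M (substExp k p (posExp (mutB B k) j)) + M (substExp k p (negExp (mutB B k) j)) ∈
            exchAlg K B M j := by
          rw [posExp_eq, substExp_add, E.subst_row]
          refine binomial_mem_exchAlg h hM ?_
          rw [substExp_apply_of_ne hjk', hnj, E.apply_eq_zero, mul_zero, add_zero]
        have := Subalgebra.add_mem _ (Subalgebra.add_mem _ m2 m1) m3
        convert this using 1
        abel
  rw [hk] at hN
  exact mem_of_pow_mul_mem hv hM (mem_exchAlg hej.ge) (mem_exchAlg (by simp [hej]))
    (mem_exchAlg E.apply_eq_zero.ge) (mem_exchAlg (by simp [E.apply_eq_zero]))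
    (mem_exchAlg E.apply_nonneg) E.form_ne N hfM hN

end Transport

/-- The elements of the upper bound of a seed. -/
def InUpperBound (K : Type*) [Field K] [Algebra K F] (B : Matrix ex (Fin n) ℤ)
    (M : (Fin n → ℤ) → F) (f : F) : Prop :=
  f ∈ Submodule.span K (Set.range M) ∧ ∀ j : ex, f ∈ exchAlg K B M j

lemma inUpperBound_of_mutate (hv : ∀ m : ℕ, 0 < m → v ^ m ≠ 1) (h : IsCompatible B Λ d)
    (hM : IsFrame v Λ M) (hM' : IsFrame v (IsCompatible.mutΛ B Λ k) M')
    (hMM' : ∀ a : Fin n → ℤ, a k = 0 → M' a = M a)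
    (hk : M' (Pi.single (k : Fin n) 1) = M (posExp B k) + M (negExp B k)) {f : F}
    (hf : InUpperBound K (mutB B k) M' f) : InUpperBound K B M f := by
  -- The direction `k` comes first: it shows that `f` is a Laurent polynomial in the old cluster,
  -- which the other directions need.
  have h1 : f ∈ exchAlg K B M k := exchAlg_mutate_le_self h hM hM' hMM' hk (hf.2 k)
  have h2 := adjoin_range_le_span hM (exchAlg_le_adjoin_range k h1)
  refine ⟨h2, fun j => ?_⟩
  by_cases hjk : j = k
  · exact hjk ▸ h1
  · exact exchAlg_mutate_transport hv h hM hM' hMM' hk hjk (hf.2 j) h2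

/-- The seed `t` stays fixed while the start of the mutation path moves back from `t` to `s`; at `t`
itself `x_i` is a monomial. -/
lemma inUpperBound_of_mutationEquiv (hv : ∀ m : ℕ, 0 < m → v ^ m ≠ 1) {s t : SeedData F ex}
    (hst : s.MutationEquiv v t) (h : IsValid v s d M) (i : Fin n) :
    InUpperBound K s.B M (t.x i) := by
  induction hst using Relation.ReflTransGen.head_induction_on generalizing M with
  | refl =>
    rw [h.x_eq]
    exact ⟨Submodule.subset_span ⟨_, rfl⟩, fun j => mem_exchAlg (by
      by_cases hij : (j : Fin n) = i <;> simp [hij])⟩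
  | head hab _ ih =>
    obtain ⟨k, rfl⟩ := hab
    obtain ⟨M', hM', h1, h2⟩ := h.exists_mutate hv k
    exact inUpperBound_of_mutate hv h.compat h.frame hM'.frame h1 h2 (ih hM')

namespace QuantumSeed

variable (S : QuantumSeed F v ex)

lemma isFrame : IsFrame v S.Λ fun a => S.ι (QuantumTorus.term v S.Λ a 1) := by
  refine ⟨S.skew, map_one S.ι, fun a b => ?_⟩
  rw [← map_mul, Units.smul_def, ← map_smul]
  congr 1
  refine (twistedMul_single v S.Λ a b 1 1).trans ?_
  rw [mul_one]
  refine Eq.trans ?_ (Finsupp.smul_single _ _ _).symm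
  rw [smul_eq_mul]

lemma exists_isValid : ∃ d, IsValid v S.toSeedData d
    fun a => S.ι (QuantumTorus.term v S.Λ a 1) := by
  obtain ⟨d, hd, h⟩ := S.compatible
  exact ⟨d, isCompatible_of_mul S.skew hd h, S.isFrame, fun i => rfl⟩

/-- The quantum Laurent phenomenon. -/
lemma clusterAlgebra_le_range (hv : ∀ m : ℕ, 0 < m → v ^ m ≠ 1) :
    S.clusterAlgebra ≤ S.ι.range := by
  obtain ⟨d, hd⟩ := S.exists_isValid
  refine Algebra.adjoin_le ?_
  rintro z ⟨t, ht, i, rfl⟩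
  have hle : Submodule.span K (Set.range fun a => S.ι (QuantumTorus.term v S.Λ a 1)) ≤
      Subalgebra.toSubmodule S.ι.range := by
    refine Submodule.span_le.2 ?_
    rintro _ ⟨a, rfl⟩
    exact ⟨_, rfl⟩
  exact hle (inUpperBound_of_mutationEquiv hv ht hd i).1

end QuantumSeed

end Laurent

namespace QuantumTorus

/-! ### Supports of Laurent polynomials -/

variable {K : Type*} [Field K] {J : Type*} [Fintype J] {v : Kˣ} {Λ : Matrix J J ℤ}

omit [Fintype J] in
@[ext]
lemma ext {f g : QuantumTorus v Λ} (h : ∀ m, f.coeff m = g.coeff m) : f = g :=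
  Finsupp.ext h

@[simp] lemma coeff_zero (m : J → ℤ) : (0 : QuantumTorus v Λ).coeff m = 0 := rfl

@[simp] lemma coeff_add (f g : QuantumTorus v Λ) (m : J → ℤ) :
    (f + g).coeff m = f.coeff m + g.coeff m := rfl

@[simp] lemma coeff_sub (f g : QuantumTorus v Λ) (m : J → ℤ) :
    (f - g).coeff m = f.coeff m - g.coeff m := Finsupp.sub_apply (ι := J → ℤ) (G := K) f g m

@[simp] lemma coeff_smul (c : K) (f : QuantumTorus v Λ) (m : J → ℤ) :
    (c • f).coeff m = c * f.coeff m := rfl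

omit [Fintype J] in
lemma coeff_term_self (a : J → ℤ) (c : K) : (term v Λ a c).coeff a = c :=
  Finsupp.single_eq_same

omit [Fintype J] in
lemma coeff_term_of_ne {a m : J → ℤ} (h : m ≠ a) (c : K) : (term v Λ a c).coeff m = 0 :=
  Finsupp.single_eq_of_ne h

lemma induction_term {motive : QuantumTorus v Λ → Prop}
    (add : ∀ f g, motive f → motive g → motive (f + g)) (term : ∀ a c, motive (term v Λ a c))
    (f : QuantumTorus v Λ) : motive f :=
  Finsupp.induction_linear (motive := motive) f
    ((Finsupp.single_zero (M := K) (0 : J → ℤ)) ▸ term 0 0) add term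

lemma term_mul_term (a b : J → ℤ) (x y : K) :
    term v Λ a x * term v Λ b y = term v Λ (a + b) (((v ^ form Λ a b : Kˣ) : K) * (x * y)) :=
  twistedMul_single v Λ a b x y

lemma smul_term (c : K) (a : J → ℤ) (x : K) : c • term v Λ a x = term v Λ a (c * x) :=
  Finsupp.smul_single c a x

lemma term_eq_smul (a : J → ℤ) (x : K) : term v Λ a x = x • term v Λ a 1 := by
  rw [smul_term, mul_one]

lemma one_eq_term : (1 : QuantumTorus v Λ) = term v Λ 0 1 := rfl

lemma toricAction_term (α : Kˣ) (w a : J → ℤ) (c : K) :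
    toricAction v Λ α w (term v Λ a c) = term v Λ a (((α ^ dotProduct w a : Kˣ) : K) * c) :=
  rescale_single α w a c

variable (v Λ) in
/-- The Laurent polynomials with exponents in `P`. -/
def supp (P : Set (J → ℤ)) : Submodule K (QuantumTorus v Λ) where
  carrier := {f | ∀ m, f.coeff m ≠ 0 → m ∈ P}
  zero_mem' := fun m hm => absurd rfl hm
  add_mem' := by
    intro f g hf hg m hm
    by_cases h : f.coeff m = 0
    · exact hg m fun h' => hm (by simp [h, h'])
    · exact hf m h
  smul_mem' := by
    intro c f hf m hm
    exact hf m fun h => hm (by simp [h])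

lemma term_mem_supp {P : Set (J → ℤ)} {a : J → ℤ} (ha : a ∈ P) (c : K) :
    term v Λ a c ∈ supp v Λ P := fun m hm => by
  by_cases h : m = a
  · exact h ▸ ha
  · exact absurd (coeff_term_of_ne h c) hm

lemma eq_sum_term (f : QuantumTorus v Λ) :
    f = ∑ a ∈ Finsupp.support (α := J → ℤ) (M := K) f, term v Λ a (f.coeff a) :=
  (Finsupp.sum_single (α := J → ℤ) (M := K) f).symm

lemma mem_of_supp {P : Set (J → ℤ)} {W : Submodule K (QuantumTorus v Λ)}
    (h : ∀ a ∈ P, term v Λ a 1 ∈ W) {f : QuantumTorus v Λ} (hf : f ∈ supp v Λ P) : f ∈ W := by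
  rw [eq_sum_term f]
  refine Submodule.sum_mem _ fun a ha => ?_
  rw [term_eq_smul]
  exact W.smul_mem _ (h a (hf a (Finsupp.mem_support_iff.1 ha)))

lemma mul_mem_supp {P P' P'' : Set (J → ℤ)} (h : ∀ a ∈ P, ∀ b ∈ P', a + b ∈ P'')
    {f g : QuantumTorus v Λ} (hf : f ∈ supp v Λ P) (hg : g ∈ supp v Λ P') :
    f * g ∈ supp v Λ P'' := by
  refine mem_of_supp (W := (supp v Λ P'').comap (LinearMap.mulRight K g)) (fun a ha => ?_) hf
  refine mem_of_supp (W := (supp v Λ P'').comap (LinearMap.mulLeft K (term v Λ a 1)))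
    (fun b hb => ?_) hg
  change term v Λ a 1 * term v Λ b 1 ∈ supp v Λ P''
  rw [term_mul_term]
  exact term_mem_supp (h a ha b hb) _

lemma coeff_term_mul (a m : J → ℤ) (f : QuantumTorus v Λ) :
    (term v Λ a 1 * f).coeff (a + m) = ((v ^ form Λ a m : Kˣ) : K) * f.coeff m := by
  have hf : f = term v Λ m (f.coeff m) + (f - term v Λ m (f.coeff m)) := by abel
  have h0 : f - term v Λ m (f.coeff m) ∈ supp v Λ {b | b ≠ m} := by
    rintro b hb rfl
    exact hb (by rw [coeff_sub, coeff_term_self, sub_self])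
  have h1 : term v Λ a 1 * (f - term v Λ m (f.coeff m)) ∈ supp v Λ {b | b ≠ a + m} :=
    mul_mem_supp (P := {a}) (fun x hx b hb => by
      rw [Set.mem_singleton_iff] at hx
      subst hx
      exact fun hc => hb (add_left_cancel hc)) (term_mem_supp (Set.mem_singleton a) _) h0
  have h2 : (term v Λ a 1 * (f - term v Λ m (f.coeff m))).coeff (a + m) = 0 := by
    by_contra hc
    exact h1 _ hc rfl
  conv_lhs => rw [hf, mul_add, coeff_add, h2, add_zero, term_mul_term, coeff_term_self, one_mul]

lemma coeff_toricAction (α : Kˣ) (w m : J → ℤ) (f : QuantumTorus v Λ) :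
    (toricAction v Λ α w f).coeff m = ((α ^ dotProduct w m : Kˣ) : K) * f.coeff m := by
  induction f using induction_term with
  | add f g hf hg => rw [map_add, coeff_add, hf, hg, coeff_add, mul_add]
  | term a c =>
    rw [toricAction_term]
    by_cases h : m = a
    · subst h
      rw [coeff_term_self, coeff_term_self]
    · rw [coeff_term_of_ne h, coeff_term_of_ne h, mul_zero]

open Classical in
variable (v Λ) in
/-- The part of a Laurent polynomial with exponents in `P`. -/
noncomputable def restrict (P : Set (J → ℤ)) : QuantumTorus v Λ →ₗ[K] QuantumTorus v Λ where
  toFun f := Finsupp.filter (α := J → ℤ) (M := K) (· ∈ P) f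
  map_add' f g := Finsupp.filter_add (α := J → ℤ) (M := K) (v := f) (v' := g)
  map_smul' c f := Finsupp.filter_smul (α := J → ℤ) (M := K) (v := f) (b := c)

lemma coeff_restrict_of_mem {P : Set (J → ℤ)} {m : J → ℤ} (h : m ∈ P) (f : QuantumTorus v Λ) :
    (restrict v Λ P f).coeff m = f.coeff m :=
  by classical exact Finsupp.filter_apply_pos _ _ h

lemma coeff_restrict_of_notMem {P : Set (J → ℤ)} {m : J → ℤ} (h : m ∉ P)
    (f : QuantumTorus v Λ) : (restrict v Λ P f).coeff m = 0 :=
  by classical exact Finsupp.filter_apply_neg _ _ h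

lemma restrict_mem_supp (P : Set (J → ℤ)) (f : QuantumTorus v Λ) :
    restrict v Λ P f ∈ supp v Λ P := fun m hm => by
  by_contra h
  exact hm (coeff_restrict_of_notMem h f)

lemma sub_restrict_mem_supp (P : Set (J → ℤ)) (f : QuantumTorus v Λ) :
    f - restrict v Λ P f ∈ supp v Λ Pᶜ := fun m hm h =>
  hm (by rw [coeff_sub, coeff_restrict_of_mem h, sub_self])

lemma restrict_of_mem {P : Set (J → ℤ)} {f : QuantumTorus v Λ} (h : f ∈ supp v Λ P) :
    restrict v Λ P f = f := by
  ext m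
  by_cases hm : m ∈ P
  · exact coeff_restrict_of_mem hm f
  · rw [coeff_restrict_of_notMem hm]
    by_contra hc
    exact hm (h m (Ne.symm hc))

lemma restrict_eq_zero {P : Set (J → ℤ)} {f : QuantumTorus v Λ} (h : f ∈ supp v Λ Pᶜ) :
    restrict v Λ P f = 0 := by
  ext m
  by_cases hm : m ∈ P
  · rw [coeff_restrict_of_mem hm, coeff_zero]
    by_contra hc
    exact h m hc hm
  · exact coeff_restrict_of_notMem hm f

lemma restrict_eq_zero_iff {P : Set (J → ℤ)} {f : QuantumTorus v Λ} :
    restrict v Λ P f = 0 ↔ ∀ m ∈ P, f.coeff m = 0 := by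
  refine ⟨fun h m hm => by rw [← coeff_restrict_of_mem hm, h, coeff_zero], fun h => ?_⟩
  exact restrict_eq_zero fun m hm hP => hm (h m hP)

/-- Setting a variable to zero is multiplicative when it occurs with nonnegative exponents only: `Q`
is the set of such exponents, `P` those free of the variable, and `R` those with a positive power of
it. -/
lemma restrict_mul {P Q R : Set (J → ℤ)} (hPP : ∀ a ∈ P, ∀ b ∈ P, a + b ∈ P)
    (hPR : ∀ a ∈ P, ∀ b ∈ Q \ P, a + b ∈ R) (hRP : ∀ a ∈ Q \ P, ∀ b ∈ Q, a + b ∈ R)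
    (hR : ∀ a ∈ R, a ∉ P) {f g : QuantumTorus v Λ} (hf : f ∈ supp v Λ Q) (hg : g ∈ supp v Λ Q) :
    restrict v Λ P (f * g) = restrict v Λ P f * restrict v Λ P g := by
  have hsub : ∀ {f : QuantumTorus v Λ}, f ∈ supp v Λ Q →
      f - restrict v Λ P f ∈ supp v Λ (Q \ P) := fun {f} hf m hm => by
    have h := sub_restrict_mem_supp P f m hm
    refine ⟨hf m fun h0 => hm ?_, h⟩
    rw [coeff_sub, coeff_restrict_of_notMem h, h0, sub_zero]
  have e : f * g = restrict v Λ P f * restrict v Λ P g +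
      (restrict v Λ P f * (g - restrict v Λ P g) + (f - restrict v Λ P f) * g) := by noncomm_ring
  have h1 : restrict v Λ P f * (g - restrict v Λ P g) + (f - restrict v Λ P f) * g ∈
      supp v Λ R :=
    Submodule.add_mem _ (mul_mem_supp hPR (restrict_mem_supp P f) (hsub hg))
      (mul_mem_supp hRP (hsub hf) hg)
  conv_lhs => rw [e, map_add, restrict_of_mem (mul_mem_supp hPP (restrict_mem_supp P f)
    (restrict_mem_supp P g)), restrict_eq_zero (fun m hm => hR m (h1 m hm)), add_zero]

lemma restrict_term_mul {P : Set (J → ℤ)} {s : J → ℤ} (hs : ∀ m, s + m ∈ P ↔ m ∈ P)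
    (f : QuantumTorus v Λ) :
    restrict v Λ P (term v Λ s 1 * f) = term v Λ s 1 * restrict v Λ P f := by
  ext m
  obtain ⟨m, rfl⟩ : ∃ m', m = s + m' := ⟨m - s, by abel⟩
  rw [coeff_term_mul]
  by_cases hm : m ∈ P
  · rw [coeff_restrict_of_mem ((hs m).2 hm), coeff_restrict_of_mem hm, coeff_term_mul]
  · rw [coeff_restrict_of_notMem (fun h => hm ((hs m).1 h)), coeff_restrict_of_notMem hm, mul_zero]

end QuantumTorus

/-! ### Completely prime torus invariant ideals in algebras of Laurent polynomials -/

section Strata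

open QuantumTorus

variable {K : Type*} [Field K] {n : ℕ} {v : Kˣ} {Λ : Matrix (Fin n) (Fin n) ℤ}

/-- The exponents which only involve the first `t` coordinates. -/
def headExps (n t : ℕ) : Set (Fin n → ℤ) := {m | ∀ i : Fin n, t ≤ i → m i = 0}

lemma add_mem_headExps {t : ℕ} {a b : Fin n → ℤ} (ha : a ∈ headExps n t)
    (hb : b ∈ headExps n t) : a + b ∈ headExps n t := fun i hi => by
  simp [ha i hi, hb i hi]

lemma add_mem_headExps_iff {t : ℕ} {a b : Fin n → ℤ} (ha : a ∈ headExps n t) :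
    a + b ∈ headExps n t ↔ b ∈ headExps n t := by
  refine ⟨fun h i hi => ?_, add_mem_headExps ha⟩
  have := h i hi
  simpa [ha i hi] using this

lemma headExps_mono {t u : ℕ} (h : t ≤ u) : headExps n t ⊆ headExps n u :=
  fun _ hm i hi => hm i (h.trans hi)

lemma mem_addSubmonoid_of_nonneg (W : AddSubmonoid (Fin n → ℤ)) {a : Fin n → ℤ} (ha : 0 ≤ a)
    (h : ∀ i, a i ≠ 0 → Pi.single i 1 ∈ W) : a ∈ W := by
  have e : a = ∑ i, (a i).toNat • (Pi.single i 1 : Fin n → ℤ) := by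
    funext j
    have h0 : ∀ i, ((a i).toNat • (Pi.single i 1 : Fin n → ℤ)) j = if j = i then a i else 0 :=
      fun i => by
        rw [Pi.smul_apply, Pi.single_apply, nsmul_eq_mul, mul_ite, mul_one, mul_zero,
          Int.toNat_of_nonneg (ha i)]
    rw [Finset.sum_apply, Finset.sum_congr rfl fun i _ => h0 i]
    simp
  rw [e]
  refine AddSubmonoid.sum_mem _ fun i _ => ?_
  by_cases hi : a i = 0
  · simp [hi]
  · exact AddSubmonoid.nsmul_mem _ (h i hi) _

/-- A completely prime ideal `P` of an algebra `A` of Laurent polynomials which contains precisely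
the variables with (zero-based) index at least `t`, and which is invariant under the toric actions
with weights in `T`. -/
structure IsStratum (A : Subalgebra K (QuantumTorus v Λ)) (T : Submodule ℤ (Fin n → ℤ))
    (P : Submodule K (QuantumTorus v Λ)) (t : ℕ) : Prop where
  le : ∀ f ∈ P, f ∈ A
  mul_left : ∀ a ∈ A, ∀ f ∈ P, a * f ∈ P
  mul_right : ∀ a ∈ A, ∀ f ∈ P, f * a ∈ P
  one_notMem : (1 : QuantumTorus v Λ) ∉ P
  mem_or_mem : ∀ a ∈ A, ∀ b ∈ A, a * b ∈ P → a ∈ P ∨ b ∈ P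
  toric : ∀ w ∈ T, ∀ f ∈ P, toricAction v Λ v w f ∈ P
  var_mem_iff : ∀ i : Fin n, X v Λ i ∈ P ↔ t ≤ i

variable {A : Subalgebra K (QuantumTorus v Λ)} {T : Submodule ℤ (Fin n → ℤ)}
  {P : Submodule K (QuantumTorus v Λ)} {t : ℕ}

lemma term_add_mem_iff (W : Submodule K (QuantumTorus v Λ)) (a b : Fin n → ℤ) :
    term v Λ a 1 * term v Λ b 1 ∈ W ↔ term v Λ (a + b) 1 ∈ W := by
  rw [term_mul_term, term_eq_smul, mul_one, mul_one]
  exact W.smul_mem_iff (Units.ne_zero _)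

lemma term_mem_of_nonneg (hA : ∀ i, X v Λ i ∈ A) {a : Fin n → ℤ} (ha : 0 ≤ a) :
    term v Λ a 1 ∈ A := by
  refine mem_addSubmonoid_of_nonneg
    { carrier := {a | term v Λ a 1 ∈ A}
      zero_mem' := A.one_mem
      add_mem' := fun {a b} ha hb => ?_ } ha fun i _ => hA i
  exact (term_add_mem_iff (Subalgebra.toSubmodule A) a b).1 (A.mul_mem ha hb)

lemma mem_of_supp_nonneg (hA : ∀ i, X v Λ i ∈ A) {f : QuantumTorus v Λ}
    (hf : f ∈ supp v Λ {m | 0 ≤ m}) : f ∈ A :=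
  mem_of_supp (W := Subalgebra.toSubmodule A) (fun _ ha => term_mem_of_nonneg hA ha) hf

namespace IsStratum

lemma term_notMem (hP : IsStratum A T P t) (hA : ∀ i, X v Λ i ∈ A) {a : Fin n → ℤ}
    (ha : 0 ≤ a) (hat : a ∈ headExps n t) : term v Λ a 1 ∉ P := by
  refine (mem_addSubmonoid_of_nonneg
    { carrier := {a | term v Λ a 1 ∈ A ∧ term v Λ a 1 ∉ P}
      zero_mem' := ⟨A.one_mem, hP.one_notMem⟩
      add_mem' := fun {a b} ha hb => ⟨?_, fun hab => ?_⟩ } ha fun i hi => ⟨hA i, fun h => ?_⟩).2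
  · exact (term_add_mem_iff (Subalgebra.toSubmodule A) a b).1 (A.mul_mem ha.1 hb.1)
  · rcases hP.mem_or_mem _ ha.1 _ hb.1 ((term_add_mem_iff P a b).2 hab) with h | h
    · exact ha.2 h
    · exact hb.2 h
  · exact hi (hat i ((hP.var_mem_iff i).1 h))

lemma term_mem (hP : IsStratum A T P t) (hA : ∀ i, X v Λ i ∈ A) {a : Fin n → ℤ}
    (ha : 0 ≤ a) {i : Fin n} (hti : t ≤ i) (hi : 0 < a i) : term v Λ a 1 ∈ P := by
  have h1 : 0 ≤ a - Pi.single i 1 := fun j => by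
    by_cases hj : j = i
    · subst hj
      simp only [Pi.zero_apply, Pi.sub_apply, Pi.single_eq_same]; omega
    · simpa [Pi.single_eq_of_ne hj] using ha j
  have h2 := hP.mul_left _ (term_mem_of_nonneg hA h1) _ ((hP.var_mem_iff i).2 hti)
  have h3 := (term_add_mem_iff P (a - Pi.single i 1) (Pi.single i 1)).1 h2
  rwa [sub_add_cancel] at h3

lemma mem_of_supp_nonneg_of_compl (hP : IsStratum A T P t) (hA : ∀ i, X v Λ i ∈ A)
    {f : QuantumTorus v Λ} (hf : f ∈ supp v Λ {m | 0 ≤ m ∧ m ∉ headExps n t}) : f ∈ P := by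
  refine mem_of_supp (fun a ha => ?_) hf
  obtain ⟨ha, hat⟩ := ha
  obtain ⟨i, hti, hi⟩ : ∃ i : Fin n, t ≤ i ∧ a i ≠ 0 := by
    by_contra! hc
    exact hat hc
  exact hP.term_mem hA ha hti (lt_of_le_of_ne (ha i) (Ne.symm hi))

/-- Moving `x_i` past `f` rescales the monomials of `f`; then `x_i ∉ P` is removed by complete
primality. Nonnegative exponents keep the rescaled polynomial in `A`. -/
lemma toric_conj_mem (hP : IsStratum A T P t) (hΛ : Λ.transpose = -Λ) (hA : ∀ i, X v Λ i ∈ A)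
    {f : QuantumTorus v Λ} (hf : f ∈ P) (hf0 : f ∈ supp v Λ {m | 0 ≤ m}) {i : Fin n}
    (hi : (i : ℕ) < t) : toricAction v Λ v ((2 : ℤ) • Λ i) f ∈ P := by
  have hw : ∀ m, dotProduct ((2 : ℤ) • Λ i) m = 2 * form Λ (Pi.single i 1) m := fun m => by
    rw [smul_dotProduct, smul_eq_mul, form, single_dotProduct, one_mul]
    rfl
  have hcomm : X v Λ i * f = toricAction v Λ v ((2 : ℤ) • Λ i) f * X v Λ i := by
    clear hf hf0
    induction f using induction_term with
    | add f g hf hg => rw [mul_add, hf, hg, map_add, add_mul]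
    | term a c =>
      rw [X, toricAction_term, term_mul_term, term_mul_term, hw, add_comm a, one_mul, mul_one,
        ← mul_assoc, ← Units.val_mul, ← zpow_add, form_antisymm hΛ a]
      congr 4
      ring
  have h1 : toricAction v Λ v ((2 : ℤ) • Λ i) f * X v Λ i ∈ P :=
    hcomm ▸ hP.mul_left _ (hA i) _ hf
  have h2 : toricAction v Λ v ((2 : ℤ) • Λ i) f ∈ A := mem_of_supp_nonneg hA fun m hm => by
    refine hf0 m fun h => hm ?_
    rw [coeff_toricAction, h, mul_zero]
  refine (hP.mem_or_mem _ h2 _ (hA i) h1).resolve_right fun h => ?_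
  have := (hP.var_mem_iff i).1 h
  omega

/-- The weights in `T` and conjugation by the first `t` variables separate exponents. -/
def Separates (T : Submodule ℤ (Fin n → ℤ)) (Λ : Matrix (Fin n) (Fin n) ℤ) (t : ℕ) : Prop :=
  ∀ m ∈ headExps n t, m ≠ 0 →
    (∃ w ∈ T, dotProduct w m ≠ 0) ∨ ∃ i : Fin n, (i : ℕ) < t ∧ dotProduct (Λ i) m ≠ 0

/-- A polynomial in the first `t` variables belonging to the ideal vanishes. -/
lemma eq_zero_of_mem (hv : ∀ m : ℕ, 0 < m → v ^ m ≠ 1) (hP : IsStratum A T P t)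
    (hΛ : Λ.transpose = -Λ) (hA : ∀ i, X v Λ i ∈ A) (hsep : Separates T Λ t)
    {f : QuantumTorus v Λ} (hf : f ∈ P) (hf0 : f ∈ supp v Λ {m | 0 ≤ m ∧ m ∈ headExps n t}) :
    f = 0 := by
  -- Shrink the support: a rescaling with different eigenvalues on two monomials gives a nonzero
  -- element of `P` with fewer terms. A single remaining monomial is excluded by `term_notMem`.
  induction hN : (Finsupp.support (α := Fin n → ℤ) (M := K) f).card using
    Nat.strong_induction_on generalizing f with
  | _ N ih =>
    by_contra hne
    obtain ⟨m, hm⟩ : ∃ m, f.coeff m ≠ 0 := by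
      by_contra! hc
      exact hne (QuantumTorus.ext hc)
    have hmP := hf0 m hm
    by_cases hall : ∀ m', f.coeff m' ≠ 0 → m' = m
    · refine hP.term_notMem hA hmP.1 hmP.2 ((P.smul_mem_iff hm).1 ?_)
      rw [← term_eq_smul]
      convert hf using 1
      ext m'
      by_cases h : m' = m
      · rw [h, coeff_term_self]
      · rw [coeff_term_of_ne h]
        by_contra hc
        exact h (hall m' (Ne.symm hc))
    · push Not at hall
      obtain ⟨m', hm', hmm'⟩ := hall
      obtain ⟨w, hw, hwP⟩ : ∃ w : Fin n → ℤ, dotProduct w m' ≠ dotProduct w m ∧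
          toricAction v Λ v w f ∈ P := by
        have hd : m' - m ∈ headExps n t := fun i hi => by
          simp [(hf0 m' hm').2 i hi, hmP.2 i hi]
        rcases hsep _ hd (sub_ne_zero.2 hmm') with ⟨w, hw, hne⟩ | ⟨i, hi, hne⟩
        · exact ⟨w, fun h => hne (by rw [dotProduct_sub, h, sub_self]), hP.toric w hw f hf⟩
        · refine ⟨(2 : ℤ) • Λ i, fun h => hne ?_,
            hP.toric_conj_mem hΛ hA hf (fun m hm => (hf0 m hm).1) hi⟩
          rw [smul_dotProduct, smul_dotProduct, smul_eq_mul, smul_eq_mul] at h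
          rw [dotProduct_sub]
          omega
      -- This removes the monomial `m` and keeps `m'`, the two weights being distinguished by powers
      -- of `v`.
      set g := toricAction v Λ v w f - ((v ^ dotProduct w m : Kˣ) : K) • f with hg
      have hgc : ∀ a, g.coeff a =
          (((v ^ dotProduct w a : Kˣ) : K) - ((v ^ dotProduct w m : Kˣ) : K)) * f.coeff a :=
        fun a => by rw [hg, coeff_sub, coeff_toricAction, coeff_smul, sub_mul]
      have hgP : g ∈ P := P.sub_mem hwP (P.smul_mem _ hf)
      have hgf : ∀ a, g.coeff a ≠ 0 → f.coeff a ≠ 0 := fun a ha h =>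
        ha (by rw [hgc, h, mul_zero])
      have hcard : (Finsupp.support (α := Fin n → ℤ) (M := K) g).card < N := by
        rw [← hN]
        refine Finset.card_lt_card ((Finset.ssubset_iff_of_subset fun a ha => ?_).2 ⟨m, ?_, ?_⟩)
        · exact Finsupp.mem_support_iff.2 (hgf a (Finsupp.mem_support_iff.1 ha))
        · exact Finsupp.mem_support_iff.2 hm
        · intro h
          refine Finsupp.mem_support_iff.1 h ((hgc m).trans ?_)
          rw [sub_self, zero_mul]
      have hg0 := ih _ hcard hgP (fun a ha => hf0 a (hgf a ha)) rfl
      have : g.coeff m' ≠ 0 := by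
        rw [hgc]
        refine mul_ne_zero (sub_ne_zero.2 fun h => hw ?_) hm'
        exact zpow_inj_of_not_root hv (Units.ext h)
      rw [hg0] at this
      exact this rfl

/-- `P` is the kernel of the multiplicative projection of `A` to the Laurent polynomials in the
first `t` variables. -/
structure IsHeadKernel (A : Subalgebra K (QuantumTorus v Λ)) (P : Submodule K (QuantumTorus v Λ))
    (t : ℕ) : Prop where
  mem_iff : ∀ f ∈ A, f ∈ P ↔ restrict v Λ (headExps n t) f = 0
  map_mul : ∀ f ∈ A, ∀ g ∈ A, restrict v Λ (headExps n t) (f * g) =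
    restrict v Λ (headExps n t) f * restrict v Λ (headExps n t) g

/-- The start of the induction: with all `n` variables kept, the projection is the identity. -/
lemma isHeadKernel_bot : IsHeadKernel A ⊥ n := by
  have h : ∀ f : QuantumTorus v Λ, restrict v Λ (headExps n n) f = f := fun f =>
    restrict_of_mem fun m _ i hi => absurd i.2 (not_lt.2 hi)
  exact ⟨fun f _ => by rw [h, Submodule.mem_bot], fun f _ g _ => by rw [h, h, h]⟩

/-! ### The induction step: setting one more variable to zero -/

section Step

variable {P' : Submodule K (QuantumTorus v Λ)}

/-- Once denominators are cleared, `P` can be tested on polynomials. Replacing `f` by its projection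
costs an element of `P' ≤ P`; terms involving a variable of index at least `t` lie in `P`; what
remains is covered by `eq_zero_of_mem`. -/
lemma term_mul_mem_iff (hv : ∀ m : ℕ, 0 < m → v ^ m ≠ 1) (hP : IsStratum A T P t)
    (hΛ : Λ.transpose = -Λ) (hA : ∀ i, X v Λ i ∈ A) (hsep : Separates T Λ t)
    (hP' : IsHeadKernel A P' (t + 1)) (hPP' : P' ≤ P) {f : QuantumTorus v Λ} (hf : f ∈ A)
    {s : Fin n → ℤ} (hs : 0 ≤ s) (hst : s ∈ headExps n (t + 1))
    (hsf : term v Λ s 1 * restrict v Λ (headExps n (t + 1)) f ∈ supp v Λ {m | 0 ≤ m}) :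
    term v Λ s 1 * f ∈ P ↔
      restrict v Λ (headExps n t) (term v Λ s 1 * restrict v Λ (headExps n (t + 1)) f) = 0 := by
  set h := term v Λ s 1 * restrict v Λ (headExps n (t + 1)) f with hh
  have hhA : h ∈ A := mem_of_supp_nonneg hA hsf
  have hFA : term v Λ s 1 * f ∈ A := A.mul_mem (term_mem_of_nonneg hA hs) hf
  have hhh : h ∈ supp v Λ (headExps n (t + 1)) :=
    mul_mem_supp (P := headExps n (t + 1)) (fun a ha b hb => add_mem_headExps ha hb)
      (term_mem_supp hst _) (restrict_mem_supp _ f)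
  have h1 : term v Λ s 1 * f - h ∈ P := hPP' <| by
    rw [hP'.mem_iff _ (A.sub_mem hFA hhA), map_sub, restrict_of_mem hhh,
      restrict_term_mul (fun m => add_mem_headExps_iff hst), hh, sub_self]
  have h2 : h - restrict v Λ (headExps n t) h ∈ P := by
    refine hP.mem_of_supp_nonneg_of_compl hA fun m hm => ?_
    have := sub_restrict_mem_supp _ h m hm
    refine ⟨hsf m fun h0 => hm ?_, this⟩
    rw [coeff_sub, coeff_restrict_of_notMem this, h0, sub_zero]
  have e : term v Λ s 1 * f = (term v Λ s 1 * f - h) + (h - restrict v Λ (headExps n t) h) +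
      restrict v Λ (headExps n t) h := by abel
  constructor
  · intro hF
    refine hP.eq_zero_of_mem hv hΛ hA hsep ?_ fun m hm => ?_
    · rw [e] at hF
      exact (P.add_mem_iff_right (P.add_mem h1 h2)).1 hF
    · have := restrict_mem_supp _ h m hm
      refine ⟨hsf m fun h0 => hm ?_, this⟩
      rw [coeff_restrict_of_mem this, h0]
  · intro h0
    rw [e]
    exact P.add_mem (P.add_mem h1 h2) (h0 ▸ P.zero_mem)

lemma exists_bound (f : QuantumTorus v Λ) :
    ∃ N : ℤ, 0 ≤ N ∧ ∀ m, f.coeff m ≠ 0 → ∀ i, 0 ≤ N + m i := by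
  refine ⟨∑ m ∈ Finsupp.support (α := Fin n → ℤ) (M := K) f, ∑ i, |m i|,
    Finset.sum_nonneg fun _ _ => Finset.sum_nonneg fun _ _ => abs_nonneg _, fun m hm i => ?_⟩
  have h1 : ∑ i, |m i| ≤ ∑ m ∈ Finsupp.support (α := Fin n → ℤ) (M := K) f, ∑ i, |m i| :=
    Finset.single_le_sum (f := fun m : Fin n → ℤ => ∑ i, |m i|)
      (fun _ _ => Finset.sum_nonneg fun _ _ => abs_nonneg _) (Finsupp.mem_support_iff.2 hm)
  have h2 : |m i| ≤ ∑ i, |m i| :=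
    Finset.single_le_sum (f := fun i => |m i|) (fun _ _ => abs_nonneg _) (Finset.mem_univ i)
  have := neg_abs_le (m i)
  omega

lemma term_mul_mem_supp {s : Fin n → ℤ} {f : QuantumTorus v Λ} {R : Set (Fin n → ℤ)}
    (h : ∀ m, f.coeff m ≠ 0 → s + m ∈ R) : term v Λ s 1 * f ∈ supp v Λ R :=
  mul_mem_supp (P := {s}) (P' := {m | f.coeff m ≠ 0})
    (fun a ha b hb => by rw [Set.mem_singleton_iff.1 ha]; exact h b hb)
    (term_mem_supp (Set.mem_singleton s) 1) fun _ hm => hm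

/-- No negative powers of the last remaining variable occur. -/
lemma nonneg_of_coeff_ne_zero (hv : ∀ m : ℕ, 0 < m → v ^ m ≠ 1) (hP : IsStratum A T P t)
    (hΛ : Λ.transpose = -Λ) (hA : ∀ i, X v Λ i ∈ A) (hsep : Separates T Λ t)
    (hP' : IsHeadKernel A P' (t + 1)) (hPP' : P' ≤ P) (ht : t < n) {f : QuantumTorus v Λ}
    (hf : f ∈ A) :
    restrict v Λ (headExps n (t + 1)) f ∈
      supp v Λ {m | m ∈ headExps n (t + 1) ∧ 0 ≤ m ⟨t, ht⟩} := by
  set g := restrict v Λ (headExps n (t + 1)) f with hg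
  have hgh : g ∈ supp v Λ (headExps n (t + 1)) := restrict_mem_supp _ f
  intro m₁ hm₁
  refine ⟨hgh m₁ hm₁, ?_⟩
  by_contra hneg
  push Not at hneg
  obtain ⟨m, hm, hmin⟩ := Finset.exists_min_image
    (Finsupp.support (α := Fin n → ℤ) (M := K) g) (fun m => m ⟨t, ht⟩)
    ⟨m₁, Finsupp.mem_support_iff.2 hm₁⟩
  have hmt : m ⟨t, ht⟩ < 0 := (hmin m₁ (Finsupp.mem_support_iff.2 hm₁)).trans_lt hneg
  have hm0 : g.coeff m ≠ 0 := Finsupp.mem_support_iff.1 hm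
  obtain ⟨N, hN, hNg⟩ := exists_bound g
  -- The exponent at `t` cancels exactly the lowest power, so `s + m` is free of the variable `t`,
  -- while `s` itself involves it and its monomial lies in `P`.
  set s : Fin n → ℤ := fun i => if (i : ℕ) < t then N else if (i : ℕ) = t then -m ⟨t, ht⟩ else 0
    with hs
  have hs0 : 0 ≤ s := fun i => by
    simp only [hs, Pi.zero_apply]
    split_ifs <;> omega
  have hst : s ∈ headExps n (t + 1) := fun i hi => by
    simp only [hs]
    rw [if_neg (by omega), if_neg (by omega)]
  have hsm : ∀ a, g.coeff a ≠ 0 → s + a ∈ {m : Fin n → ℤ | 0 ≤ m} := fun a ha i => by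
    simp only [hs, Pi.zero_apply, Pi.add_apply]
    split_ifs with h1 h2
    · exact hNg a ha i
    · have := hmin a (Finsupp.mem_support_iff.2 ha)
      have hi : i = ⟨t, ht⟩ := Fin.ext h2
      rw [hi]
      omega
    · rw [hgh a ha i (by omega), add_zero]
  have hsP : term v Λ s 1 ∈ P :=
    hP.term_mem hA hs0 (i := ⟨t, ht⟩) le_rfl (by simp only [hs]; simp; omega)
  have h0 := (hP.term_mul_mem_iff hv hΛ hA hsep hP' hPP' hf hs0 hst
    (term_mul_mem_supp hsm)).1 (hP.mul_right _ hf _ hsP)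
  have hsmt : s + m ∈ headExps n t := fun i hi => by
    rcases hi.eq_or_lt with h | h
    · have hi : i = ⟨t, ht⟩ := Fin.ext h.symm
      subst hi
      simp [hs]
    · exact add_mem_headExps hst (hgh m hm0) i h
  have h1 := restrict_eq_zero_iff.1 h0 _ hsmt
  rw [coeff_term_mul] at h1
  exact mul_ne_zero (Units.ne_zero _) hm0 h1

lemma isHeadKernel (hv : ∀ m : ℕ, 0 < m → v ^ m ≠ 1) (hP : IsStratum A T P t)
    (hΛ : Λ.transpose = -Λ) (hA : ∀ i, X v Λ i ∈ A) (hsep : Separates T Λ t)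
    (hP' : IsHeadKernel A P' (t + 1)) (hPP' : P' ≤ P) (ht : t < n) : IsHeadKernel A P t := by
  have hrr : ∀ f : QuantumTorus v Λ, restrict v Λ (headExps n t) f =
      restrict v Λ (headExps n t) (restrict v Λ (headExps n (t + 1)) f) := fun f => by
    ext m
    by_cases hm : m ∈ headExps n t
    · rw [coeff_restrict_of_mem hm, coeff_restrict_of_mem hm,
        coeff_restrict_of_mem (headExps_mono (Nat.le_succ t) hm)]
    · rw [coeff_restrict_of_notMem hm, coeff_restrict_of_notMem hm]
  have hnn := fun {f} (hf : f ∈ A) => hP.nonneg_of_coeff_ne_zero hv hΛ hA hsep hP' hPP' ht hf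
  have hpos : ∀ m ∈ {m : Fin n → ℤ | m ∈ headExps n (t + 1) ∧ 0 ≤ m ⟨t, ht⟩} \ headExps n t,
      0 < m ⟨t, ht⟩ := by
    rintro m ⟨⟨hm, hm0⟩, hmt⟩
    refine lt_of_le_of_ne hm0 fun h => hmt fun i hi => ?_
    rcases hi.eq_or_lt with h' | h'
    · have hi : i = ⟨t, ht⟩ := Fin.ext h'.symm
      rw [hi, ← h]
    · exact hm i h'
  refine ⟨fun f hf => ?_, fun f hf g hg => ?_⟩
  · set g := restrict v Λ (headExps n (t + 1)) f with hg
    obtain ⟨N, hN, hNg⟩ := exists_bound g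
    -- The variable `t` occurs with nonnegative exponents, so a monomial in the first `t` variables
    -- clears denominators. It is not in `P` and can be cancelled.
    set s : Fin n → ℤ := fun i => if (i : ℕ) < t then N else 0 with hs
    have hs0 : 0 ≤ s := fun i => by
      simp only [hs, Pi.zero_apply]
      split_ifs <;> omega
    have hst : s ∈ headExps n t := fun i hi => by
      simp only [hs]
      rw [if_neg (by omega)]
    have hsm : ∀ a, g.coeff a ≠ 0 → s + a ∈ {m : Fin n → ℤ | 0 ≤ m} := fun a ha i => by
      have h := hnn hf a ha
      simp only [hs, Pi.zero_apply, Pi.add_apply]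
      split_ifs with h1
      · exact hNg a ha i
      · rw [zero_add]
        rcases (not_lt.1 h1).eq_or_lt with h2 | h2
        · have hi : i = ⟨t, ht⟩ := Fin.ext h2.symm
          rw [hi]
          exact h.2
        · exact (h.1 i h2).ge
    have hsA := term_mem_of_nonneg hA hs0
    have h1 := hP.term_mul_mem_iff hv hΛ hA hsep hP' hPP' hf hs0
      (headExps_mono (Nat.le_succ t) hst) (term_mul_mem_supp hsm)
    rw [restrict_term_mul (fun m => add_mem_headExps_iff hst), ← hrr] at h1
    constructor
    · intro h
      have h2 := h1.1 (hP.mul_left _ hsA _ h)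
      ext m
      have h3 := coeff_term_mul (v := v) (Λ := Λ) s m (restrict v Λ (headExps n t) f)
      rw [h2, coeff_zero] at h3
      exact (mul_eq_zero.1 h3.symm).resolve_left (Units.ne_zero _)
    · intro h
      rw [h, mul_zero] at h1
      exact (hP.mem_or_mem _ hsA _ hf (h1.2 rfl)).resolve_left (hP.term_notMem hA hs0 hst)
  · rw [hrr, hP'.map_mul f hf g hg, hrr f, hrr g]
    refine restrict_mul (R := {m | 0 < m ⟨t, ht⟩}) (fun a ha b hb => add_mem_headExps ha hb)
      (fun a ha b hb => ?_) (fun a ha b hb => ?_) (fun a ha hat => ?_) (hnn hf) (hnn hg)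
    · have := hpos b hb
      simpa [ha ⟨t, ht⟩ le_rfl] using this
    · have h1 := hpos a ha
      have h2 := hb.2
      exact add_pos_of_pos_of_nonneg h1 h2
    · exact (ne_of_gt ha) (hat ⟨t, ht⟩ le_rfl)

end Step

end IsStratum

end Strata

section Final

open QuantumTorus

variable {K : Type*} [Field K] {F : Type*} [DivisionRing F] [Algebra K F]
variable {n : ℕ} {ex : Finset (Fin n)} {v : Kˣ}

/-! ### The quantum torus in the first variables -/

section Head

variable {t : ℕ} (ht : t ≤ n)

/-- Extension of exponents by zero. -/
def extendExp (n : ℕ) {t : ℕ} (m : Fin t → ℤ) : Fin n → ℤ :=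
  fun i => if h : (i : ℕ) < t then m ⟨i, h⟩ else 0

lemma extendExp_castLE (m : Fin t → ℤ) (i : Fin t) : extendExp n m (Fin.castLE ht i) = m i := by
  simp [extendExp]

lemma extendExp_comp_castLE {m : Fin n → ℤ} (hm : m ∈ headExps n t) :
    extendExp n (m ∘ Fin.castLE ht) = m := by
  funext i
  by_cases h : (i : ℕ) < t
  · simp only [extendExp, h, dif_pos, Function.comp_apply]
    rfl
  · simp [extendExp, h, hm i (not_lt.1 h)]

lemma extendExp_mem (m : Fin t → ℤ) : extendExp n m ∈ headExps n t := fun i hi => by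
  simp [extendExp, not_lt.2 hi]

lemma extendExp_add (a b : Fin t → ℤ) :
    extendExp n (a + b) = extendExp n a + extendExp n b := by
  funext i
  by_cases h : (i : ℕ) < t <;> simp [extendExp, h]

lemma extendExp_injective (ht : t ≤ n) : Function.Injective (extendExp n : (Fin t → ℤ) → _) := fun a b h => by
  funext i
  rw [← extendExp_castLE ht a, h, extendExp_castLE]

lemma extendExp_single (i : Fin t) :
    extendExp n (Pi.single i 1) = Pi.single (Fin.castLE ht i) 1 := by
  funext j
  by_cases h : (j : ℕ) < t
  · simp [extendExp, h, Pi.single_apply, Fin.ext_iff]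
  · have : j ≠ Fin.castLE ht i := fun hc => h (by rw [hc]; exact i.2)
    simp [extendExp, h, Pi.single_eq_of_ne this]

lemma dotProduct_extendExp (w : Fin n → ℤ) (m : Fin t → ℤ) :
    dotProduct w (extendExp n m) = dotProduct (w ∘ Fin.castLE ht) m := by
  refine (Fintype.sum_of_injective (Fin.castLE ht) (Fin.castLE_injective ht) _ _ ?_ ?_).symm
  · intro i hi
    have : ¬ (i : ℕ) < t := fun h => hi ⟨⟨i, h⟩, rfl⟩
    simp [extendExp, this]
  · intro i
    rw [extendExp_castLE, Function.comp_apply]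

lemma form_extendExp (Λ : Matrix (Fin n) (Fin n) ℤ) (a b : Fin t → ℤ) :
    form Λ (extendExp n a) (extendExp n b) =
      form (Λ.submatrix (Fin.castLE ht) (Fin.castLE ht)) a b := by
  rw [form, dotProduct_comm, dotProduct_extendExp ht, dotProduct_comm, form]
  congr 1
  funext i
  exact dotProduct_extendExp ht _ b

/-- The linear map underlying `headEmbedding`. -/
noncomputable def headLinear (v : Kˣ) (Λ : Matrix (Fin n) (Fin n) ℤ) :
    QuantumTorus v (Λ.submatrix (Fin.castLE ht) (Fin.castLE ht)) →ₗ[K] QuantumTorus v Λ :=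
  Finsupp.lmapDomain K K (extendExp n)

lemma headLinear_term (Λ : Matrix (Fin n) (Fin n) ℤ) (a : Fin t → ℤ) (c : K) :
    headLinear ht v Λ (term v _ a c) = term v Λ (extendExp n a) c :=
  Finsupp.mapDomain_single

lemma headLinear_mul (Λ : Matrix (Fin n) (Fin n) ℤ)
    (f g : QuantumTorus v (Λ.submatrix (Fin.castLE ht) (Fin.castLE ht))) :
    headLinear ht v Λ (f * g) = headLinear ht v Λ f * headLinear ht v Λ g := by
  induction f using induction_term with
  | add f₁ f₂ h₁ h₂ => rw [add_mul, map_add, map_add, add_mul, h₁, h₂]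
  | term a x =>
    induction g using induction_term with
    | add f₁ f₂ h₁ h₂ => rw [mul_add, map_add, map_add, mul_add, h₁, h₂]
    | term b y =>
      rw [term_mul_term, headLinear_term, headLinear_term, headLinear_term, term_mul_term,
        extendExp_add, form_extendExp ht]

/-- The embedding of the quantum torus in the first `t` variables. -/
noncomputable def headEmbedding (v : Kˣ) (Λ : Matrix (Fin n) (Fin n) ℤ) :
    QuantumTorus v (Λ.submatrix (Fin.castLE ht) (Fin.castLE ht)) →ₐ[K] QuantumTorus v Λ :=
  AlgHom.ofLinearMap (headLinear ht v Λ)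
    (by
      rw [one_eq_term, headLinear_term, one_eq_term]
      congr 1
      funext i
      simp [extendExp])
    (headLinear_mul ht Λ)

lemma headEmbedding_term (Λ : Matrix (Fin n) (Fin n) ℤ) (a : Fin t → ℤ) (c : K) :
    headEmbedding ht v Λ (term v _ a c) = term v Λ (extendExp n a) c :=
  headLinear_term ht Λ a c

lemma headEmbedding_injective (Λ : Matrix (Fin n) (Fin n) ℤ) :
    Function.Injective (headEmbedding ht v Λ) :=
  Finsupp.mapDomain_injective (extendExp_injective ht)

lemma mem_range_headEmbedding {Λ : Matrix (Fin n) (Fin n) ℤ} {f : QuantumTorus v Λ}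
    (hf : f ∈ supp v Λ (headExps n t)) : f ∈ (headEmbedding ht v Λ).range :=
  mem_of_supp (W := Subalgebra.toSubmodule (headEmbedding ht v Λ).range)
    (fun a ha => ⟨term v _ (a ∘ Fin.castLE ht) 1, (headEmbedding_term ht Λ _ 1).trans
      (congrArg (term v Λ · 1) (extendExp_comp_castLE ht ha))⟩) hf

end Head

/-! ### The stratification of the cluster algebra -/

namespace QuantumSeed

variable (S : QuantumSeed F v ex)

/-- An exponent that is not separated gives a linear form vanishing on a sublattice of full rank
`t`; its image then has rank zero, so it vanishes. -/
lemma separates (hst : S.IsSuperToric) {t : ℕ} (ht : t ≤ n) :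
    IsStratum.Separates S.weights S.Λ t := by
  intro m hm hm0
  by_contra! hc
  obtain ⟨hc1, hc2⟩ := hc
  set d : Fin t → ℤ := m ∘ Fin.castLE ht with hd
  have hmd : extendExp n d = m := extendExp_comp_castLE ht hm
  have hd0 : d ≠ 0 := fun h => hm0 (by rw [← hmd, h]; funext i; simp [extendExp])
  have ht1 : 1 ≤ t := by
    by_contra h
    have : t = 0 := by omega
    subst this
    exact hd0 (Subsingleton.elim _ _)
  set l : (Fin t → ℤ) →ₗ[ℤ] ℤ := Fintype.linearCombination ℤ d with hl
  have hl' : ∀ x, l x = dotProduct x d := fun x => by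
    rw [hl, Fintype.linearCombination_apply]; rfl
  have hle : S.weights.map (LinearMap.funLeft ℤ ℤ (Fin.castLE ht)) ⊔
      LinearMap.range (S.principal t ht).mulVecLin ≤ LinearMap.ker l := by
    refine sup_le ?_ ?_
    · rintro _ ⟨w, hw, rfl⟩
      rw [LinearMap.mem_ker, hl']
      refine (dotProduct_extendExp ht w d).symm.trans ?_
      rw [hmd]
      exact hc1 w hw
    · rintro _ ⟨y, rfl⟩
      rw [LinearMap.mem_ker, hl', Matrix.mulVecLin_apply, dotProduct_comm]
      change form _ _ _ = 0
      rw [principal, ← form_extendExp ht, form_antisymm S.skew, hmd, form, neg_eq_zero,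
        dotProduct_comm, dotProduct_extendExp ht]
      refine (dotProduct_comm _ _).trans ?_
      refine Finset.sum_eq_zero fun i _ => ?_
      have : dotProduct (S.Λ (Fin.castLE ht i)) m = 0 := hc2 _ i.2
      exact mul_eq_zero_of_right _ this
  have h1 := Submodule.finrank_mono hle
  rw [hst t ht ht1] at h1
  have h2 := Submodule.finrank_quotient_add_finrank (LinearMap.ker l)
  rw [Module.finrank_fintype_fun_eq_card, Fintype.card_fin,
    l.quotKerEquivRange.finrank_eq] at h2
  have h3 : Module.finrank ℤ (LinearMap.range l) = 0 := by omega
  have h4 : LinearMap.range l = ⊥ := Submodule.finrank_eq_zero.1 h3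
  obtain ⟨i, hi⟩ : ∃ i, d i ≠ 0 := by
    by_contra! h
    exact hd0 (funext h)
  have h5 : l (Pi.single i 1) ∈ LinearMap.range l := ⟨_, rfl⟩
  rw [h4, Submodule.mem_bot, hl', single_dotProduct, one_mul] at h5
  exact hi h5

/-- The Laurent polynomials which represent an element of the ideal `I`. -/
def laurentIdeal (I : TwoSidedIdeal S.clusterAlgebra) : Submodule K (QuantumTorus v S.Λ) where
  carrier := {f | ∃ h : S.ι f ∈ S.clusterAlgebra, (⟨S.ι f, h⟩ : S.clusterAlgebra) ∈ I}
  zero_mem' := ⟨by rw [map_zero]; exact zero_mem _, by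
    convert I.zero_mem
    exact map_zero S.ι⟩
  add_mem' := by
    rintro f g ⟨hf, hf'⟩ ⟨hg, hg'⟩
    refine ⟨by rw [map_add]; exact add_mem hf hg, ?_⟩
    convert I.add_mem hf' hg'
    exact map_add S.ι f g
  smul_mem' := by
    rintro c f ⟨hf, hf'⟩
    refine ⟨by rw [map_smul]; exact Subalgebra.smul_mem _ hf c, ?_⟩
    convert I.mul_mem_left (algebraMap K S.clusterAlgebra c) _ hf'
    rw [← Algebra.smul_def]
    exact map_smul S.ι c f

variable {S}

lemma mem_laurentIdeal {I : TwoSidedIdeal S.clusterAlgebra} {a : S.clusterAlgebra}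
    {f : QuantumTorus v S.Λ} (h : S.ι f = a) : f ∈ S.laurentIdeal I ↔ a ∈ I := by
  obtain ⟨a, ha⟩ := a
  subst h
  exact ⟨fun ⟨_, h⟩ => h, fun h => ⟨ha, h⟩⟩

variable (S)

lemma isStratum {I : TwoSidedIdeal S.clusterAlgebra} (hI : IsCompletelyPrime I)
    (hT : S.IsTorusInvariant I) {t : ℕ} (hvar : ∀ i, S.var i ∈ I ↔ t ≤ i) :
    IsStratum (S.clusterAlgebra.comap S.ι) S.weights (S.laurentIdeal I) t where
  le f hf := hf.1
  mul_left a ha f hf := by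
    have e : S.ι (a * f) = ((⟨S.ι a, ha⟩ * ⟨S.ι f, hf.1⟩ : S.clusterAlgebra) : F) :=
      map_mul S.ι a f
    exact (mem_laurentIdeal e).2 (I.mul_mem_left _ _ hf.2)
  mul_right a ha f hf := by
    have e : S.ι (f * a) = ((⟨S.ι f, hf.1⟩ * ⟨S.ι a, ha⟩ : S.clusterAlgebra) : F) :=
      map_mul S.ι f a
    exact (mem_laurentIdeal e).2 (I.mul_mem_right _ _ hf.2)
  one_notMem h := by
    have e : S.ι 1 = ((1 : S.clusterAlgebra) : F) := map_one S.ι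
    exact hI.1 (I.one_mem_iff.1 ((mem_laurentIdeal e).1 h))
  mem_or_mem a ha b hb hab := by
    have e : S.ι (a * b) = ((⟨S.ι a, ha⟩ * ⟨S.ι b, hb⟩ : S.clusterAlgebra) : F) :=
      map_mul S.ι a b
    exact (hI.2 _ _ ((mem_laurentIdeal e).1 hab)).imp (fun h => ⟨ha, h⟩) fun h => ⟨hb, h⟩
  -- The single parameter `α = v` suffices, since its powers are distinct.
  toric w hw f hf := hT w hw v f hf.1 hf.2
  var_mem_iff i := (mem_laurentIdeal (a := S.var i) rfl).trans (hvar i)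

lemma isHeadKernel_of_isCOS (hv : ∀ m : ℕ, 0 < m → v ^ m ≠ 1)
    (hcp : ∀ P : TwoSidedIdeal S.clusterAlgebra, IsPrimeIdeal P → IsCompletelyPrime P)
    (hst : S.IsSuperToric) {r : ℕ} {I : ℕ → TwoSidedIdeal S.clusterAlgebra} (hI : S.IsCOS r I)
    {t : ℕ} (hk : n < t + 1 + r) (hkn : t + 1 ≤ n) :
    IsStratum.IsHeadKernel (S.clusterAlgebra.comap S.ι) (S.laurentIdeal (I (t + 1))) t := by
  -- Descending induction on `t`, measured by `j = n - (t + 1)`; for `j = 0` the preceding ideal is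
  -- zero, otherwise it is `I (t + 2)`.
  obtain ⟨j, hj⟩ := Nat.exists_eq_add_of_le hkn
  induction j generalizing t with
  | zero =>
    have hP := S.isStratum (hcp _ (hI.prime _ hk hkn)) (hI.torusInvariant _ hk hkn) (t := t)
      fun i => (hI.var_mem_iff _ hk hkn i).trans (by omega)
    refine hP.isHeadKernel hv S.skew (fun i => (S.var i).2) (S.separates hst (by omega)) ?_ bot_le
      (by omega)
    have : t + 1 = n := by omega
    rw [this]
    exact IsStratum.isHeadKernel_bot
  | succ j ih =>
    have hP := S.isStratum (hcp _ (hI.prime _ hk hkn)) (hI.torusInvariant _ hk hkn) (t := t)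
      fun i => (hI.var_mem_iff _ hk hkn i).trans (by omega)
    refine hP.isHeadKernel hv S.skew (fun i => (S.var i).2) (S.separates hst (by omega))
      (ih (t := t + 1) (by omega) (by omega) (by omega)) ?_ (by omega)
    rintro f ⟨hf, hf'⟩
    exact ⟨hf, hI.chain _ hk (by omega) hf'⟩

/-- The Laurent expansion of the elements of the quantum cluster algebra. -/
noncomputable def laurent (hv : ∀ m : ℕ, 0 < m → v ^ m ≠ 1) :
    S.clusterAlgebra →ₐ[K] QuantumTorus v S.Λ :=
  ((AlgEquiv.ofInjective S.ι S.injective).symm : S.ι.range →ₐ[K] QuantumTorus v S.Λ).comp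
    (Subalgebra.inclusion (S.clusterAlgebra_le_range hv))

lemma ι_laurent (hv : ∀ m : ℕ, 0 < m → v ^ m ≠ 1) (a : S.clusterAlgebra) :
    S.ι (S.laurent hv a) = a :=
  congrArg Subtype.val ((AlgEquiv.ofInjective S.ι S.injective).apply_symm_apply
    (Subalgebra.inclusion (S.clusterAlgebra_le_range hv) a))

/-- The projection of the Laurent expansion is an algebra map by `map_mul`; its values lie in the
range of the injective `headEmbedding`, which is inverted there. -/
lemma exists_headHom (hv : ∀ m : ℕ, 0 < m → v ^ m ≠ 1) {P : Submodule K (QuantumTorus v S.Λ)}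
    {t : ℕ} (ht : t ≤ n) (hP : IsStratum.IsHeadKernel (S.clusterAlgebra.comap S.ι) P t) :
    ∃ ψ : S.clusterAlgebra →ₐ[K] QuantumTorus v (S.principal t ht),
      ∀ a, headEmbedding ht v S.Λ (ψ a) = restrict v S.Λ (headExps n t) (S.laurent hv a) := by
  have hmem : ∀ a, S.laurent hv a ∈ S.clusterAlgebra.comap S.ι := fun a => by
    rw [Subalgebra.mem_comap, S.ι_laurent hv]
    exact a.2
  let π : S.clusterAlgebra →ₐ[K] QuantumTorus v S.Λ :=
    AlgHom.ofLinearMap (restrict v S.Λ (headExps n t) ∘ₗ (S.laurent hv).toLinearMap)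
      (by
        rw [LinearMap.comp_apply, AlgHom.toLinearMap_apply, map_one]
        have h0 : (0 : Fin n → ℤ) ∈ headExps n t := fun _ _ => rfl
        exact restrict_of_mem (term_mem_supp h0 1))
      (fun a b => by
        simp only [LinearMap.comp_apply, AlgHom.toLinearMap_apply, map_mul]
        exact hP.map_mul _ (hmem a) _ (hmem b))
  let e := AlgEquiv.ofInjective (headEmbedding ht v S.Λ) (headEmbedding_injective ht S.Λ)
  have hπ : ∀ a, π a ∈ (headEmbedding ht v S.Λ).range := fun a =>
    mem_range_headEmbedding ht (restrict_mem_supp _ _)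
  refine ⟨e.symm.toAlgHom.comp (π.codRestrict _ hπ), fun a => ?_⟩
  exact congrArg Subtype.val (e.apply_symm_apply (π.codRestrict _ hπ a))

end QuantumSeed

end Final

end QCluster

theorem mainTheorem1 {K : Type*} [Field K] [CharZero K]
    (v : Kˣ) (hv : ∀ m : ℕ, 0 < m → v ^ m ≠ 1)
    {F : Type*} [DivisionRing F] [Algebra K F] {n : ℕ} {ex : Finset (Fin n)}
    (S : QCluster.QuantumSeed F v ex)
    (hcp : ∀ P : TwoSidedIdeal S.clusterAlgebra,
      QCluster.IsPrimeIdeal P → QCluster.IsCompletelyPrime P)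
    (hst : S.IsSuperToric)
    (r : ℕ) (I : ℕ → TwoSidedIdeal S.clusterAlgebra) (hI : S.IsCOS r I)
    (k : ℕ) (hk : n < k + r) (hkn : k ≤ n) :
    (∃ φ : (I k).ringCon.Quotient →ₐ[K]
          QCluster.QuantumTorus v (S.principal (k - 1) ((Nat.sub_le k 1).trans hkn)),
        Function.Injective φ ∧
        ∀ i : Fin (k - 1),
          φ ((I k).ringCon.mkₐ K (S.var (Fin.castLE ((Nat.sub_le k 1).trans hkn) i))) =
            QCluster.QuantumTorus.X v _ i) ∧
    (∀ a : S.clusterAlgebra, ∃! f : QCluster.QuantumTorus v S.Λ, S.ι f = a) ∧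
    (∀ (a : S.clusterAlgebra) (f : QCluster.QuantumTorus v S.Λ), S.ι f = a →
      (a ∈ I k ↔
        ∀ m : Fin n → ℤ, (∀ i : Fin n, k ≤ (i : ℕ) + 1 → m i = 0) → f.coeff m = 0)) := by

  -- Here `k ≥ 1` because `r ≤ n < k + r`; the zero-based index of `x_k` is `t`.
  obtain ⟨t, rfl⟩ : ∃ t, k = t + 1 := ⟨k - 1, by have := hI.depth_le; omega⟩
  have ht : t + 1 - 1 ≤ n := (Nat.sub_le (t + 1) 1).trans hkn
  have hK := S.isHeadKernel_of_isCOS hv hcp hst hI hk hkn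
  obtain ⟨ψ, hψ⟩ := S.exists_headHom hv ht hK
  have hmem : ∀ (a : S.clusterAlgebra) (f : QCluster.QuantumTorus v S.Λ), S.ι f = a →
      (a ∈ I (t + 1) ↔ QCluster.QuantumTorus.restrict v S.Λ (QCluster.headExps n t) f = 0) :=
    fun a f h => (QCluster.QuantumSeed.mem_laurentIdeal h).symm.trans
      (hK.mem_iff f (by rw [Subalgebra.mem_comap, h]; exact a.2))
  have hker : ∀ a, a ∈ I (t + 1) ↔ ψ a = 0 := fun a => by
    rw [hmem a _ (S.ι_laurent hv a)]
    refine Iff.trans ?_ (map_eq_zero_iff _ (QCluster.headEmbedding_injective ht S.Λ))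
    rw [hψ]
    rfl
  -- Equality of the congruences gives both the factorization of `ψ` through the quotient and its
  -- injectivity.
  have hrel : (I (t + 1)).ringCon = RingCon.ker ψ.toRingHom := by
    ext a b
    rw [TwoSidedIdeal.rel_iff, hker, map_sub, sub_eq_zero]
    rfl
  refine ⟨⟨RingCon.liftₐ _ ψ hrel.le, ?_, fun i => ?_⟩, fun a => ?_, fun a f h => ?_⟩
  · rw [RingCon.coe_liftₐ]
    exact RingCon.lift_injective_iff.2 hrel
  · refine (RingCon.liftₐ_mk _ ψ hrel.le _).trans (QCluster.headEmbedding_injective ht S.Λ ?_)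
    have h1 : S.laurent hv (S.var (Fin.castLE ht i)) =
        QCluster.QuantumTorus.X v S.Λ (Fin.castLE ht i) := S.injective (S.ι_laurent hv _)
    rw [hψ, h1, QCluster.QuantumTorus.X]
    refine Eq.trans ?_ (QCluster.headEmbedding_term ht S.Λ _ 1).symm
    rw [← QCluster.extendExp_single ht]
    exact QCluster.QuantumTorus.restrict_of_mem
      (QCluster.QuantumTorus.term_mem_supp (QCluster.extendExp_mem _) 1)
  · exact ⟨S.laurent hv a, S.ι_laurent hv a, fun f hf =>
      S.injective (hf.trans (S.ι_laurent hv a).symm)⟩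
  · rw [hmem a f h, QCluster.QuantumTorus.restrict_eq_zero_iff]
    refine forall_congr' fun m => imp_congr_left (forall_congr' fun i => imp_congr_left ?_)
    omega
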